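/- Let $\alpha_1<\alpha_2<\alpha_3$ be real, $\phi(z)=(z-\alpha_1)(z-\alpha_2)(z-\alpha_3)$, and let $k_1,k_2$ be positive integers. Elliptic coordinates $(u_1,u_2)$, $\alpha_1<u_1<\alpha_2<u_2<\alpha_3$, of a point $q\in S^2\subset\mathbb R^3$ are defined by the identity in $z$ $$\frac{q_1^2}{z-\alpha_1}+\frac{q_2^2}{z-\alpha_2}+\frac{q_3^2}{z-\alpha_3}=\frac{(z-u_1)(z-u_2)}{\phi(z)} ;$$ they are smooth coordinates on each of the eight open octants of $S^2$: the inverse of $q\mapsto u$ is a smooth immersion mapping the rectangle bijectively onto the octant. Let $(u,p)$ be the corresponding canonical coordinates on the cotangent bundle, $\{u_i,u_j\}=\{p_i,p_j\}=0$, $\{u_i,p_j\}=\delta_{ij}$, and put $$\mathrm g=\frac1{u_1-u_2}\begin{pmatrix}\phi(u_1)/k_1^2&0\\0&-\phi(u_2)/k_2^2\end{pmatrix},\qquad H=I_1=\sum_{i,j}\mathrm g_{ij}p_ip_j,$$ $$I_2=\frac{u_2\phi(u_1)p_1^2}{k_1^2(u_2-u_1)}+\frac{u_1\phi(u_2)p_2^2}{k_2^2(u_1-u_2)}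 .$$ (With these sign conventions $\mathrm g$ is negative definite.) Write $f(x)=\phi(x)(xI_1+I_2)=a_4x^4+a_3x^3+a_2x^2+a_1x+a_0$. The points $P_i=(u_i,\phi(u_i)p_i/k_i)$, $i=1,2$, lie on the curve $y^2=f(x)$. Let $s$ be any continuous branch of $\sqrt{a_4}=\sqrt{I_1}$ (complex-valued) off the zero section $p=0$; such branches exist. Points of the curve are added by Euler's formulas: $(x_1,y_1)+(x_2,y_2)=(x_3,-\mathcal P(x_3))$, where $\mathcal P(x)=b_2x^2+b_1x+b_0$ and $$x_3=-x_1-x_2-\frac{2b_0b_2+b_1^2-a_2}{2b_1b_2-a_3},$$ $$\mathcal P(x)=s(x-x_1)(x-x_2)+\frac{(x-x_2)y_1}{x_1-x_2}+\frac{(x-x_1)y_2}{x_2-x_1}\quad\text{for } x_1\ne x_2,$$ while $[2](x_1,y_1)=(x_1,y_1)+(x_1,y_1)$ is given by the same formulas with $x_2=x_1$ and $\mathcal P(x)=s(x-x_1)^2+\frac{(x-x_1)f'(x_1)}{2y_1}+y_1$. Put $[1]P=P$ and $[m+1]P=[m]P+P$ for $m\ge2$. Alternatively, $[3]$ may be given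 instead by the closed formula $$[3](x_1,y_1)=(X,-\mathcal P(X)),\qquad X=-3x_1-\frac{a_3-2b_1b_2}{a_4-b_2^2},$$ $$\mathcal P(x)=\Bigl(\frac{f''(x_1)}{4y_1}-\frac{f'(x_1)^2}{8y_1^3}\Bigr)(x-x_1)^2+\frac{f'(x_1)}{2y_1}(x-x_1)+y_1,$$ with $[m+1]P=[m]P+P$ for $m\ge3$. Writing $[k_i]P_i=(X_i,Y_i)$, let $$C_{k_1k_2}=\Bigl(\frac{Y_1-Y_2}{X_1-X_2}\Bigr)^2-a_4(X_1+X_2)^2-a_3(X_1+X_2),$$ a complex-valued function on the set $U$ of all $(u,p)$ with $p\neq0$ at which no denominator in these formulas vanishes. Then $H$ and $I_2$ are smooth and $\{H,I_2\}=0$ everywhere on the phase space $\{(u,p)\}$. For each of the two definitions of $[3]$ and each branch $s$, the set $U$ is open and dense in the phase space, $C_{k_1k_2}$ is smooth on $U$, $\{H,C_{k_1k_2}\}=0$ on $U$, and $H$, $I_2$, $C_{k_1k_2}$ are functionally independent on $U$: their differentials are linearly independent (over $\mathbb C$) at the points of a dense subset of $U$. Thus $\mathrm g$ is a superintegrable metric.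 -/

import Mathlib

open scoped ContDiff

namespace EulerSphere

/-! ### Elliptic coordinates on the sphere -/

/-- The cubic polynomial `φ(z) = (z - α₁)(z - α₂)(z - α₃)`. -/
def phi (α : Fin 3 → ℝ) (z : ℝ) : ℝ := (z - α 0) * (z - α 1) * (z - α 2)

/-- The rectangle `α₁ < u₁ < α₂ < u₂ < α₃` in which elliptic coordinates take their values. -/
def ellipticDomain (α : Fin 3 → ℝ) : Set (Fin 2 → ℝ) :=
  {u | α 0 < u 0 ∧ u 0 < α 1 ∧ α 1 < u 1 ∧ u 1 < α 2}

/-- `u` is a pair of elliptic coordinates of the point `q` of `ℝ³`: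
`∑ qᵢ² / (z - αᵢ) = (z - u₁)(z - u₂) / φ(z)` identically in `z`. -/
def IsEllipticCoordinates (α : Fin 3 → ℝ) (q : EuclideanSpace ℝ (Fin 3)) (u : Fin 2 → ℝ) : Prop :=
  ∀ z : ℝ, (∀ i, z ≠ α i) →
    ∑ i, q i ^ 2 / (z - α i) = (z - u 0) * (z - u 1) / phi α z

/-- The open octant of the unit sphere `S²` in which the `i`-th coordinate has the sign of `ε i`. -/
def sphereOctant (ε : Fin 3 → ℝ) : Set (EuclideanSpace ℝ (Fin 3)) :=
  {q | q ∈ Metric.sphere (0 : EuclideanSpace ℝ (Fin 3)) 1 ∧ ∀ i, 0 < ε i * q i}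

/-- `Φ` is the inverse of the elliptic coordinate chart on the open octant of `S²` with signs `ε`:
a smooth immersion which maps the coordinate rectangle bijectively onto the octant, such that
`u` are the elliptic coordinates of `Φ u`. -/
structure IsEllipticParametrization (α : Fin 3 → ℝ) (ε : Fin 3 → ℝ)
    (Φ : (Fin 2 → ℝ) → EuclideanSpace ℝ (Fin 3)) : Prop where
  smooth : ContDiffOn ℝ ∞ Φ (ellipticDomain α)
  bijOn : Set.BijOn Φ (ellipticDomain α) (sphereOctant ε)
  elliptic : ∀ u ∈ ellipticDomain α, IsEllipticCoordinates α (Φ u) u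
  immersion : ∀ u ∈ ellipticDomain α, Function.Injective (fderiv ℝ Φ u)

/-! ### Phase space, Poisson bracket, first integrals -/

/-- Pairs `(u, p)` of coordinates `u = (u₁, u₂)` and conjugate momenta `p = (p_{u₁}, p_{u₂})`. -/
abbrev Phase : Type := (Fin 2 → ℝ) × (Fin 2 → ℝ)

/-- The part of `T*S²` over (an octant of) the sphere in the canonical coordinates `(u, p)`
belonging to the elliptic coordinates `u`. -/
def phaseSpace (α : Fin 3 → ℝ) : Set Phase := {z | z.1 ∈ ellipticDomain α}

/-- The complement of the zero section in `phaseSpace α`. -/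
def slitPhaseSpace (α : Fin 3 → ℝ) : Set Phase := {z | z ∈ phaseSpace α ∧ z.2 ≠ 0}

/-- `∂F/∂uᵢ`. -/
noncomputable def dU (i : Fin 2) (F : Phase → ℂ) (z : Phase) : ℂ :=
  fderiv ℝ F z (Pi.single i 1, 0)

/-- `∂F/∂p_{uᵢ}`. -/
noncomputable def dP (i : Fin 2) (F : Phase → ℂ) (z : Phase) : ℂ :=
  fderiv ℝ F z (0, Pi.single i 1)

/-- The canonical Poisson bracket, with `{uᵢ, uⱼ} = {p_{uᵢ}, p_{uⱼ}} = 0`, `{uᵢ, p_{uⱼ}} = δᵢⱼ`,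
of complex-valued functions on the real phase space. -/
noncomputable def poissonBracket (F G : Phase → ℂ) (z : Phase) : ℂ :=
  ∑ i, (dU i F z * dP i G z - dP i F z * dU i G z)

/-- `F` is a smooth function on the set `U` which is in involution with `H` there. -/
structure IsFirstIntegralOn (H F : Phase → ℂ) (U : Set Phase) : Prop where
  smooth : ContDiffOn ℝ ∞ F U
  involution : ∀ z ∈ U, poissonBracket H F z = 0

/-- The functions `F i` are functionally independent on `U`: their differentials are linearly
independent at the points of a dense subset of `U`. -/
def FunctionallyIndependentOn {n : ℕ} (F : Fin n → Phase → ℂ) (U : Set Phase) : Prop :=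
  U ⊆ closure {z | z ∈ U ∧ LinearIndependent ℂ (fun i => fderiv ℝ (F i) z)}

/-! ### The metric, its geodesic Hamiltonian and the quadratic integral -/

/-- The diagonal matrix `g` of coefficients of the geodesic Hamiltonian. -/
noncomputable def metric (α : Fin 3 → ℝ) (k : Fin 2 → ℕ) (u : Fin 2 → ℝ) :
    Matrix (Fin 2) (Fin 2) ℝ :=
  (1 / (u 0 - u 1)) •
    !![(u 0 - α 0) * (u 0 - α 1) * (u 0 - α 2) / (k 0 : ℝ) ^ 2, 0;
       0, (α 0 - u 1) * (α 1 - u 1) * (α 2 - u 1) / (k 1 : ℝ) ^ 2]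

/-- The geodesic Hamiltonian `H = I₁ = ∑ gᵢⱼ p_{uᵢ} p_{uⱼ}`. -/
noncomputable def ham (α : Fin 3 → ℝ) (k : Fin 2 → ℕ) (z : Phase) : ℝ :=
  ∑ i, ∑ j, metric α k z.1 i j * z.2 i * z.2 j

/-- The quadratic integral `I₂`. -/
noncomputable def I₂ (α : Fin 3 → ℝ) (k : Fin 2 → ℕ) (z : Phase) : ℝ :=
  z.1 1 * phi α (z.1 0) * z.2 0 ^ 2 / ((k 0 : ℝ) ^ 2 * (z.1 1 - z.1 0)) +
    z.1 0 * phi α (z.1 1) * z.2 1 ^ 2 / ((k 1 : ℝ) ^ 2 * (z.1 0 - z.1 1))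

/-! ### Euler's arithmetic on the curve `y² = f(x) = a₄x⁴ + a₃x³ + a₂x² + a₁x + a₀`

The coefficients are `a i`, `i = 0, …, 4`, and `s` is a square root of `a 4`. The neutral element
is one of the two points at infinity. Each operation is a rational expression, and comes with the
condition that its denominators do not vanish. -/

/-- `f(x)`. -/
def quartic (a : Fin 5 → ℂ) (x : ℂ) : ℂ :=
  a 4 * x ^ 4 + a 3 * x ^ 3 + a 2 * x ^ 2 + a 1 * x + a 0

/-- `f'(x)`. -/
def quartic' (a : Fin 5 → ℂ) (x : ℂ) : ℂ :=
  4 * a 4 * x ^ 3 + 3 * a 3 * x ^ 2 + 2 * a 2 * x + a 1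

/-- `f''(x)`. -/
def quartic'' (a : Fin 5 → ℂ) (x : ℂ) : ℂ :=
  12 * a 4 * x ^ 2 + 6 * a 3 * x + 2 * a 2

/-- The polynomial `𝒫(x) = b₂x² + b₁x + b₀`. -/
structure Parabola where
  b0 : ℂ
  b1 : ℂ
  b2 : ℂ

/-- The value `𝒫(x)`. -/
def Parabola.eval (b : Parabola) (x : ℂ) : ℂ := b.b2 * x ^ 2 + b.b1 * x + b.b0

/-- `𝒫(x) = s(x - x₁)(x - x₂) + (x - x₂)y₁/(x₁ - x₂) + (x - x₁)y₂/(x₂ - x₁)`. -/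
noncomputable def chord (s : ℂ) (P Q : ℂ × ℂ) : Parabola where
  b2 := s
  b1 := (P.2 - Q.2) / (P.1 - Q.1) - s * (P.1 + Q.1)
  b0 := s * P.1 * Q.1 + (P.1 * Q.2 - Q.1 * P.2) / (P.1 - Q.1)

/-- `𝒫(x) = s(x - x₁)² + (x - x₁)f'(x₁)/(2y₁) + y₁`. -/
noncomputable def tangent (a : Fin 5 → ℂ) (s : ℂ) (P : ℂ × ℂ) : Parabola where
  b2 := s
  b1 := quartic' a P.1 / (2 * P.2) - 2 * s * P.1
  b0 := s * P.1 ^ 2 - P.1 * quartic' a P.1 / (2 * P.2) + P.2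

/-- Half of the second derivative of `y = √f(x)` at the point `P` of the curve. -/
noncomputable def osculatingCoeff (a : Fin 5 → ℂ) (P : ℂ × ℂ) : ℂ :=
  quartic'' a P.1 / (4 * P.2) - quartic' a P.1 ^ 2 / (8 * P.2 ^ 3)

/-- The parabola having a contact of order three with the curve:
`𝒫(x) = c(x - x₁)² + (x - x₁)f'(x₁)/(2y₁) + y₁`, `c = f''(x₁)/(4y₁) - f'(x₁)²/(8y₁³)`. -/
noncomputable def osculating (a : Fin 5 → ℂ) (P : ℂ × ℂ) : Parabola :=
  tangent a (osculatingCoeff a P) P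

/-- The point `(x₃, -𝒫(x₃))`, where `x₁`, `x₂` and `x₃ = -x₁ - x₂ - (2b₀b₂ + b₁² - a₂)/(2b₁b₂ - a₃)`
are the abscissas of the finite points of intersection of `y = 𝒫(x)` with the curve when
`b₂² = a₄`. -/
noncomputable def thirdPoint (a : Fin 5 → ℂ) (b : Parabola) (x₁ x₂ : ℂ) : ℂ × ℂ :=
  let x₃ := -x₁ - x₂ - (2 * b.b0 * b.b2 + b.b1 ^ 2 - a 2) / (2 * b.b1 * b.b2 - a 3)
  (x₃, -b.eval x₃)

/-- The sum of two points with different abscissas. -/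
noncomputable def addPoint (a : Fin 5 → ℂ) (s : ℂ) (P Q : ℂ × ℂ) : ℂ × ℂ :=
  thirdPoint a (chord s P Q) P.1 Q.1

/-- The formula for the sum makes sense. -/
def AddDefined (a : Fin 5 → ℂ) (s : ℂ) (P Q : ℂ × ℂ) : Prop :=
  P.1 ≠ Q.1 ∧ 2 * (chord s P Q).b1 * (chord s P Q).b2 - a 3 ≠ 0

/-- The doubling of a point. -/
noncomputable def doublePoint (a : Fin 5 → ℂ) (s : ℂ) (P : ℂ × ℂ) : ℂ × ℂ :=
  thirdPoint a (tangent a s P) P.1 P.1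

/-- The formula for doubling makes sense. -/
def DoubleDefined (a : Fin 5 → ℂ) (s : ℂ) (P : ℂ × ℂ) : Prop :=
  P.2 ≠ 0 ∧ 2 * (tangent a s P).b1 * (tangent a s P).b2 - a 3 ≠ 0

/-- The tripling of a point by the closed formula free of `√a₄`:
`[3]x₁ = -3x₁ - (a₃ - 2b₁b₂)/(a₄ - b₂²)`, `[3]y₁ = -𝒫([3]x₁)`. -/
noncomputable def triplePoint (a : Fin 5 → ℂ) (P : ℂ × ℂ) : ℂ × ℂ :=
  let b := osculating a P
  let x₃ := -3 * P.1 - (a 3 - 2 * b.b1 * b.b2) / (a 4 - b.b2 ^ 2)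
  (x₃, -b.eval x₃)

/-- The closed formula for tripling makes sense. -/
def TripleDefined (a : Fin 5 → ℂ) (P : ℂ × ℂ) : Prop :=
  P.2 ≠ 0 ∧ a 4 - (osculating a P).b2 ^ 2 ≠ 0

/-- The two ways of tripling a point: `[3]P = [2]P + P` by the formulas for doubling and addition,
or the closed formula `triplePoint`. (The results differ by the class of the difference of the two
points at infinity.) -/
inductive TriplingRule : Type
  | iterated
  | closed

/-- Scalar multiplication `[m]P`, `m ≥ 1`, by `[1]P = P`, doubling, tripling and
`[m + 1]P = [m]P + P`. (The value at `m = 0` is a dummy.) -/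
noncomputable def mulPoint (rule : TriplingRule) (a : Fin 5 → ℂ) (s : ℂ) (P : ℂ × ℂ) : ℕ → ℂ × ℂ
  | 0 => (0, 0)
  | 1 => P
  | 2 => doublePoint a s P
  | 3 => match rule with
    | .iterated => addPoint a s (doublePoint a s P) P
    | .closed => triplePoint a P
  | m + 4 => addPoint a s (mulPoint rule a s P (m + 3)) P

/-- All the formulas used in the computation of `[m]P` make sense. -/
def MulDefined (rule : TriplingRule) (a : Fin 5 → ℂ) (s : ℂ) (P : ℂ × ℂ) : ℕ → Prop
  | 0 => False
  | 1 => True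
  | 2 => DoubleDefined a s P
  | 3 => match rule with
    | .iterated => DoubleDefined a s P ∧ AddDefined a s (doublePoint a s P) P
    | .closed => TripleDefined a P
  | m + 4 => MulDefined rule a s P (m + 3) ∧ AddDefined a s (mulPoint rule a s P (m + 3)) P

/-- Euler's algebraic integral
`C = ((y₁ - y₂)/(x₁ - x₂))² - a₄(x₁ + x₂)² - a₃(x₁ + x₂)` of two points of the curve. -/
noncomputable def eulerC (a : Fin 5 → ℂ) (P Q : ℂ × ℂ) : ℂ :=
  ((P.2 - Q.2) / (P.1 - Q.1)) ^ 2 - a 4 * (P.1 + Q.1) ^ 2 - a 3 * (P.1 + Q.1)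

/-! ### Euler's integral on the phase space -/

/-- The coefficients of `f(x) = φ(x)(x I₁ + I₂)`, where `I₁ = H`. -/
noncomputable def coeffs (α : Fin 3 → ℝ) (k : Fin 2 → ℕ) (z : Phase) : Fin 5 → ℂ :=
  let e₁ := α 0 + α 1 + α 2
  let e₂ := α 0 * α 1 + α 0 * α 2 + α 1 * α 2
  let e₃ := α 0 * α 1 * α 2
  let J₁ := ham α k z
  let J₂ := I₂ α k z
  ![((-e₃ * J₂ : ℝ) : ℂ), ((e₂ * J₂ - e₃ * J₁ : ℝ) : ℂ), ((e₂ * J₁ - e₁ * J₂ : ℝ) : ℂ),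
    ((J₂ - e₁ * J₁ : ℝ) : ℂ), ((J₁ : ℝ) : ℂ)]

/-- The point `Pᵢ = (uᵢ, φ(uᵢ) p_{uᵢ} / kᵢ)`. -/
noncomputable def divisorPoint (α : Fin 3 → ℝ) (k : Fin 2 → ℕ) (z : Phase) (i : Fin 2) : ℂ × ℂ :=
  (((z.1 i : ℝ) : ℂ), ((phi α (z.1 i) * z.2 i / (k i : ℝ) : ℝ) : ℂ))

/-- The point `[kᵢ]Pᵢ`; the function `s` is the chosen branch of `√a₄ = √I₁`. -/
noncomputable def multiple (rule : TriplingRule) (α : Fin 3 → ℝ) (k : Fin 2 → ℕ) (s : Phase → ℂ)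
    (z : Phase) (i : Fin 2) : ℂ × ℂ :=
  mulPoint rule (coeffs α k z) (s z) (divisorPoint α k z i) (k i)

/-- The function `C_{k₁k₂}` on the phase space. -/
noncomputable def eulerIntegral (rule : TriplingRule) (α : Fin 3 → ℝ) (k : Fin 2 → ℕ)
    (s : Phase → ℂ) (z : Phase) : ℂ :=
  eulerC (coeffs α k z) (multiple rule α k s z 0) (multiple rule α k s z 1)

/-- The set of points of the phase space off the zero section at which `[k₁]P₁`, `[k₂]P₂` and
`C_{k₁k₂}` are defined, i.e. no denominator vanishes. -/
def regularSet (rule : TriplingRule) (α : Fin 3 → ℝ) (k : Fin 2 → ℕ) (s : Phase → ℂ) :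
    Set Phase :=
  {z | z ∈ slitPhaseSpace α ∧
    (∀ i, MulDefined rule (coeffs α k z) (s z) (divisorPoint α k z i) (k i)) ∧
    (multiple rule α k s z 0).1 ≠ (multiple rule α k s z 1).1}

/-- `s` is a continuous branch of `√H` off the zero section. -/
def IsSqrtBranch (α : Fin 3 → ℝ) (k : Fin 2 → ℕ) (s : Phase → ℂ) : Prop :=
  ContinuousOn s (slitPhaseSpace α) ∧ ∀ z ∈ slitPhaseSpace α, s z ^ 2 = (ham α k z : ℂ)

end EulerSphere

namespace EulerSphere

/-! ### Intersections of a parabola with the curve -/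

/-! On a common level set of `I₁ = H` and `I₂` the curve is fixed, and the separation identity `uᵢ
I₁ + I₂ = φ(uᵢ) pᵢ² / kᵢ²` puts both `Pᵢ` on it. For each `i` the field `flowField`, written `Xᵢ`
below, is tangent to the level set, moves `Pᵢ` so that `dx / y = dt` (speed 1) and leaves the other
point at rest. Since `dx / y` is the invariant differential, addition of points adds speeds, so
`[m]P` has `m` times the speed of `P`. This is Abel's theorem for the intersections of the curve
with a parabola, and it is checked by differentiating Euler's formulas (`moves_thirdPoint`,
`moves_triplePoint`, `moves_mulPoint`). The closed tripling formula also multiplies the speed by 3.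

For points with speeds `μ₁`, `μ₂` the derivative of `C` is a multiple of `μ₁ + μ₂`
(`hasDerivAt_eulerC`). The Hamiltonian field is a multiple of `X₀ / k₀ - X₁ / k₁`
(`poissonBracket_ham`), which gives `[k₁]P₁` and `[k₂]P₂` opposite speeds, whence `{H, C} = 0`. As
each `Xᵢ` annihilates `I₂`, also `{H, I₂} = 0`. No flow is integrated: velocities are derivatives at
`t = 0` along the lines `z + t Xᵢ(z)`, so the coefficients of the curve are only required to be
stationary at `t = 0`.

For density, a denominator vanishing on a nonempty open set would have zero derivative along `Xᵢ` as
well. Value and derivative together force `f` to be a square or to have a multiple root, or `m² = 1`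
for a sum `[m]P + P` with `m ≥ 2`. On `nonsingularSet`, which contains a nonempty open part of every
nonempty open set, `f` has simple roots. So an open set can be shrunk past one denominator after
another (`exists_isOpen_ne_zero`).

For independence, `X₀` annihilates `dH` and `dI₂`, so it suffices that `X₀ C` is not zero on an open
set. If it were, the straight line through the two multiples would vanish at the abscissa of their
sum. Differentiating this relation along `X₀` makes `f` a square (`moving_sum_snd_eq_zero`). -/

/-- `f(x) - 𝒫(x)² = (A x + B)(x - x₁)(x - x₂)` identically in `x`, where `b₂² = a₄`. -/
structure Intersects (a : Fin 5 → ℂ) (b : Parabola) (A B x₁ x₂ : ℂ) : Prop where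
  coeff4 : a 4 = b.b2 ^ 2
  coeff3 : a 3 = A + 2 * b.b1 * b.b2
  coeff2 : a 2 = 2 * b.b0 * b.b2 + b.b1 ^ 2 + B - A * (x₁ + x₂)
  coeff1 : a 1 = 2 * b.b0 * b.b1 + A * x₁ * x₂ - B * (x₁ + x₂)
  coeff0 : a 0 = b.b0 ^ 2 + B * x₁ * x₂

/-- The point `P` lies on the curve. -/
def OnCurve (a : Fin 5 → ℂ) (P : ℂ × ℂ) : Prop := P.2 ^ 2 = quartic a P.1

theorem chord_eval_left (s : ℂ) {P Q : ℂ × ℂ} (h : P.1 ≠ Q.1) : (chord s P Q).eval P.1 = P.2 := by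
  have := sub_ne_zero.2 h
  simp only [chord, Parabola.eval]
  field_simp
  ring

theorem chord_eval_right (s : ℂ) {P Q : ℂ × ℂ} (h : P.1 ≠ Q.1) :
    (chord s P Q).eval Q.1 = Q.2 := by
  have := sub_ne_zero.2 h
  simp only [chord, Parabola.eval]
  field_simp
  ring

/-- As `s² = a₄`, the difference `f - 𝒫²` is a cubic, and it vanishes at the two abscissas. -/
theorem intersects_chord {a : Fin 5 → ℂ} {s : ℂ} {P Q : ℂ × ℂ} (hs : s ^ 2 = a 4)
    (hP : OnCurve a P) (hQ : OnCurve a Q) (h : P.1 ≠ Q.1) :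
    ∃ A B, A = a 3 - 2 * (chord s P Q).b1 * (chord s P Q).b2 ∧
      Intersects a (chord s P Q) A B P.1 Q.1 := by
  have h1 := chord_eval_left s h
  have h2 := chord_eval_right s h
  have hb : (chord s P Q).b2 = s := rfl
  generalize chord s P Q = b at *
  obtain ⟨x, y⟩ := P
  obtain ⟨x', y'⟩ := Q
  simp only [OnCurve, quartic, Parabola.eval] at *
  have h' := sub_ne_zero.2 h
  subst hb
  subst h1 h2
  -- `B` is read off from the coefficient of `x²`. What remains is a polynomial of degree at most
  -- one with two distinct zeros, so its coefficients vanish after multiplication by `x - x'`.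
  refine ⟨_, a 2 - 2 * b.b0 * b.b2 - b.b1 ^ 2 + (a 3 - 2 * b.b1 * b.b2) * (x + x'), rfl,
    hs.symm, by ring, by ring, mul_left_cancel₀ h' ?_, mul_left_cancel₀ h' ?_⟩
  · linear_combination hQ - hP + (x ^ 4 - x' ^ 4) * hs
  · linear_combination x' * hP - x * hQ - (x' * x ^ 4 - x * x' ^ 4) * hs

theorem tangent_eval (a : Fin 5 → ℂ) (s : ℂ) (P : ℂ × ℂ) : (tangent a s P).eval P.1 = P.2 := by
  simp only [tangent, Parabola.eval]
  ring

theorem tangent_slope (a : Fin 5 → ℂ) (s : ℂ) {P : ℂ × ℂ} (h : P.2 ≠ 0) :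
    2 * P.2 * (2 * s * P.1 + (tangent a s P).b1) = quartic' a P.1 := by
  simp only [tangent]
  field_simp
  ring

/-- The confluent case: `f - 𝒫²` vanishes at `x₁` together with its derivative. -/
theorem intersects_tangent {a : Fin 5 → ℂ} {s : ℂ} {P : ℂ × ℂ} (hs : s ^ 2 = a 4)
    (hP : OnCurve a P) (h : P.2 ≠ 0) :
    ∃ A B, A = a 3 - 2 * (tangent a s P).b1 * (tangent a s P).b2 ∧
      Intersects a (tangent a s P) A B P.1 P.1 := by
  have h1 := tangent_eval a s P
  have h2 := tangent_slope a s h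
  have hb : (tangent a s P).b2 = s := rfl
  generalize tangent a s P = b at *
  obtain ⟨x, y⟩ := P
  simp only [OnCurve, quartic, quartic', Parabola.eval] at *
  subst hb
  subst h1
  refine ⟨_, a 2 - 2 * b.b0 * b.b2 - b.b1 ^ 2 + (a 3 - 2 * b.b1 * b.b2) * (x + x), rfl,
    hs.symm, by ring, by ring, ?_, ?_⟩
  · linear_combination (-1 : ℂ) * h2 + 4 * x ^ 3 * hs
  · linear_combination (-1 : ℂ) * hP + x * h2 - 3 * x ^ 4 * hs

/-- `f` is not the square of a quadratic polynomial. -/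
def IsNotSquare (a : Fin 5 → ℂ) : Prop := ∀ b x₁ x₂, ¬ Intersects a b 0 0 x₁ x₂

/-- The rational expression for `x₃` is just the root of the remaining linear factor `A x + B`; all
later computations use it in this form. -/
theorem thirdPoint_fst {a : Fin 5 → ℂ} {b : Parabola} {A B x₁ x₂ : ℂ}
    (h : Intersects a b A B x₁ x₂) (hA : A ≠ 0) : A * (thirdPoint a b x₁ x₂).1 = -B := by
  have e : 2 * b.b1 * b.b2 - a 3 = -A := by rw [h.coeff3]; ring
  simp only [thirdPoint]
  rw [e, h.coeff2]
  field_simp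
  ring

theorem thirdPoint_snd (a : Fin 5 → ℂ) (b : Parabola) (x₁ x₂ : ℂ) :
    (thirdPoint a b x₁ x₂).2 = -b.eval (thirdPoint a b x₁ x₂).1 := rfl

theorem onCurve_thirdPoint {a : Fin 5 → ℂ} {b : Parabola} {A B x₁ x₂ : ℂ}
    (h : Intersects a b A B x₁ x₂) (hA : A ≠ 0) : OnCurve a (thirdPoint a b x₁ x₂) := by
  have h1 := thirdPoint_fst h hA
  rw [OnCurve, thirdPoint_snd]
  generalize (thirdPoint a b x₁ x₂).1 = x at *
  obtain rfl : B = -(A * x) := by rw [h1, neg_neg]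
  simp only [quartic, Parabola.eval, h.coeff4, h.coeff3, h.coeff2, h.coeff1, h.coeff0]
  ring

/-! ### Motion of a point on the curve -/

/-- At the time `0` the point `P t` is on the curve with coefficients `a t` and moves so that
`dx / dt = μ y`, `dy / dt = μ f'(x) / 2`. -/
structure Moves (a : ℝ → Fin 5 → ℂ) (P : ℝ → ℂ × ℂ) (μ : ℂ) : Prop where
  on : OnCurve (a 0) (P 0)
  fst : HasDerivAt (fun t => (P t).1) (μ * (P 0).2) 0
  snd : HasDerivAt (fun t => (P t).2) (μ * (quartic' (a 0) (P 0).1 / 2)) 0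

/-- At the time `0`, the parabola `b t` has the velocity of a parabola with constant `b₂` through
two points of a constant curve that move with speeds `μ₁` and `μ₂`. -/
structure ParabolaMoves (b : ℝ → Parabola) (A B x₁ x₂ μ₁ μ₂ : ℂ) : Prop where
  b2 : HasDerivAt (fun t => (b t).b2) 0 0
  b1 : HasDerivAt (fun t => (b t).b1) (((A * x₁ + B) * μ₁ + (A * x₂ + B) * μ₂) / 2) 0
  b0 : HasDerivAt (fun t => (b t).b0)
    (-(x₂ * (A * x₁ + B) * μ₁ + x₁ * (A * x₂ + B) * μ₂) / 2) 0

/-- Differentiating `f - 𝒫² = (A x + B)(x - x₁)(x - x₂)` in time at `x = x₁`, with `x₁' = μ₁ 𝒫(x₁)`,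
suggests `𝒫'(x₁) = (A x₁ + B)(x₁ - x₂) μ₁ / 2` for the time derivative, and likewise at `x₂`. Since
`b₂` is stationary, `𝒫'` is linear in `x` and is found by interpolation. -/
theorem parabolaMoves_chord {a : ℝ → Fin 5 → ℂ} {s : ℝ → ℂ} {P Q : ℝ → ℂ × ℂ} {μ₁ μ₂ A B : ℂ}
    (hs' : HasDerivAt s 0 0) (hP : Moves a P μ₁) (hQ : Moves a Q μ₂) (h : (P 0).1 ≠ (Q 0).1)
    (hI : Intersects (a 0) (chord (s 0) (P 0) (Q 0)) A B (P 0).1 (Q 0).1) :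
    ParabolaMoves (fun t => chord (s t) (P t) (Q t)) A B (P 0).1 (Q 0).1 μ₁ μ₂ := by
  have h1 := chord_eval_left (s 0) h
  have h2 := chord_eval_right (s 0) h
  have hb : (chord (s 0) (P 0) (Q 0)).b2 = s 0 := rfl
  have h' := sub_ne_zero.2 h
  have d1 := ((hP.snd.sub hQ.snd).div (hP.fst.sub hQ.fst) h').sub
    (hs'.mul (hP.fst.add hQ.fst))
  have d0 := ((hs'.mul hP.fst).mul hQ.fst).add
    (((hP.fst.mul hQ.snd).sub (hQ.fst.mul hP.snd)).div (hP.fst.sub hQ.fst) h')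
  refine ⟨hs', d1.congr_deriv ?_, d0.congr_deriv ?_⟩
  all_goals
    clear d0 d1
    simp only [Pi.sub_apply, Pi.add_apply, Pi.mul_apply, quartic', hI.coeff4, hI.coeff3, hI.coeff2,
      hI.coeff1]
    generalize chord (s 0) (P 0) (Q 0) = b at *
    generalize (P 0).1 = x at *
    generalize (Q 0).1 = x' at *
    rw [← h1, ← h2, ← hb]
    simp only [Parabola.eval]
    field_simp
    ring

/-- The velocity of `f'(x)`. -/
theorem Moves.quartic' {a : ℝ → Fin 5 → ℂ} {P : ℝ → ℂ × ℂ} {μ : ℂ}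
    (ha : ∀ i, HasDerivAt (fun t => a t i) 0 0) (hP : Moves a P μ) :
    HasDerivAt (fun t => quartic' (a t) (P t).1) (μ * (quartic'' (a 0) (P 0).1 * (P 0).2)) 0 := by
  have d := ((((((ha 4).const_mul 4).mul (hP.fst.pow 3)).add
    (((ha 3).const_mul 3).mul (hP.fst.pow 2))).add (((ha 2).const_mul 2).mul hP.fst)).add (ha 1))
  refine d.congr_deriv ?_
  simp only [quartic'', Pi.pow_apply]
  ring

theorem parabolaMoves_tangent {a : ℝ → Fin 5 → ℂ} {s : ℝ → ℂ} {P : ℝ → ℂ × ℂ} {μ A B : ℂ}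
    (ha : ∀ i, HasDerivAt (fun t => a t i) 0 0)
    (hs' : HasDerivAt s 0 0) (hP : Moves a P μ) (h : (P 0).2 ≠ 0)
    (hI : Intersects (a 0) (tangent (a 0) (s 0) (P 0)) A B (P 0).1 (P 0).1) :
    ParabolaMoves (fun t => tangent (a t) (s t) (P t)) A B (P 0).1 (P 0).1 μ μ := by
  have h2 := tangent_slope (a 0) (s 0) h
  have h2' : 2 * (P 0).2 ≠ 0 := mul_ne_zero two_ne_zero h
  have hb : (tangent (a 0) (s 0) (P 0)).b2 = s 0 := rfl
  have h1 := tangent_eval (a 0) (s 0) (P 0)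
  -- The second derivative of `f = 𝒫² + (A x + B)(x - x₁)²` at the point of contact.
  have h3 : quartic'' (a 0) (P 0).1 = 2 * (2 * s 0 * (P 0).1 + (tangent (a 0) (s 0) (P 0)).b1) ^ 2
      + 4 * (P 0).2 * s 0 + 2 * (A * (P 0).1 + B) := by
    generalize tangent (a 0) (s 0) (P 0) = b at *
    rw [← h1, ← hb]
    simp only [quartic'', hI.coeff4, hI.coeff3, hI.coeff2, Parabola.eval]
    ring
  have dq := (hP.quartic' ha).div (hP.snd.const_mul 2) h2'
  have d1 := dq.sub ((hs'.const_mul 2).mul hP.fst)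
  have d0 := ((hs'.mul (hP.fst.pow 2)).sub
    ((hP.fst.mul (hP.quartic' ha)).div (hP.snd.const_mul 2) h2')).add hP.snd
  refine ⟨hs', d1.congr_deriv ?_, d0.congr_deriv ?_⟩
  all_goals
    clear d0 d1 dq
    simp only [Pi.mul_apply, Pi.pow_apply, h3, ← h2]
    field_simp
    ring

/-- Abel's theorem: at the root `x₃` of `A x + B` the time derivative of `𝒫` is `-A (x₃ - x₁)(x₃ -
x₂)(μ₁ + μ₂) / 2`, so the third intersection has speed `-(μ₁ + μ₂)`, and the reflection `y ↦ -y`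
reverses the sign. Chords and tangents are covered together, because only `ParabolaMoves` and
`Intersects` enter. -/
theorem moves_thirdPoint {a : ℝ → Fin 5 → ℂ} {b : ℝ → Parabola} {x₁ x₂ : ℝ → ℂ} {A B μ₁ μ₂ : ℂ}
    (ha : ∀ i, HasDerivAt (fun t => a t i) 0 0)
    (h₁ : HasDerivAt x₁ (μ₁ * (b 0).eval (x₁ 0)) 0)
    (h₂ : HasDerivAt x₂ (μ₂ * (b 0).eval (x₂ 0)) 0)
    (hb : ParabolaMoves b A B (x₁ 0) (x₂ 0) μ₁ μ₂)
    (hI : Intersects (a 0) (b 0) A B (x₁ 0) (x₂ 0)) (hA : A ≠ 0) :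
    Moves a (fun t => thirdPoint (a t) (b t) (x₁ t) (x₂ t)) (μ₁ + μ₂) := by
  have e : 2 * (b 0).b1 * (b 0).b2 - a 0 3 = -A := by rw [hI.coeff3]; ring
  have e' : 2 * (b 0).b1 * (b 0).b2 - a 0 3 ≠ 0 := by rw [e]; exact neg_ne_zero.2 hA
  have hx := thirdPoint_fst hI hA
  have dx : HasDerivAt (fun t => (thirdPoint (a t) (b t) (x₁ t) (x₂ t)).1)
      ((μ₁ + μ₂) * (thirdPoint (a 0) (b 0) (x₁ 0) (x₂ 0)).2) 0 := by
    have d := (h₁.neg.sub h₂).sub (((((hb.b0.const_mul 2).mul hb.b2).add (hb.b1.pow 2)).sub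
      (ha 2)).div (((hb.b1.const_mul 2).mul hb.b2).sub (ha 3)) e')
    refine d.congr_deriv ?_
    simp only [Pi.sub_apply, Pi.add_apply, Pi.mul_apply, Pi.pow_apply, e, thirdPoint_snd]
    generalize (thirdPoint (a 0) (b 0) (x₁ 0) (x₂ 0)).1 = x at *
    obtain rfl : B = -(A * x) := by rw [hx, neg_neg]
    simp only [hI.coeff2, Parabola.eval]
    field_simp
    ring
  refine ⟨onCurve_thirdPoint hI hA, dx, ?_⟩
  have d := (((hb.b2.mul (dx.pow 2)).add (hb.b1.mul dx)).add hb.b0).neg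
  refine d.congr_deriv ?_
  simp only [Pi.pow_apply, thirdPoint_snd]
  clear d dx
  generalize (thirdPoint (a 0) (b 0) (x₁ 0) (x₂ 0)).1 = x at *
  obtain rfl : B = -(A * x) := by rw [hx, neg_neg]
  simp only [hI.coeff4, hI.coeff3, hI.coeff2, hI.coeff1, Parabola.eval, EulerSphere.quartic']
  ring

/-! ### Parabolas having a contact of order three with the curve -/

/-- `f(x) - 𝒫(x)² = (A x + B)(x - x₁)³` identically in `x`. -/
structure Osculates (a : Fin 5 → ℂ) (b : Parabola) (A B x₁ : ℂ) : Prop where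
  coeff4 : a 4 = b.b2 ^ 2 + A
  coeff3 : a 3 = 2 * b.b1 * b.b2 + B - 3 * x₁ * A
  coeff2 : a 2 = 2 * b.b0 * b.b2 + b.b1 ^ 2 - 3 * x₁ * B + 3 * x₁ ^ 2 * A
  coeff1 : a 1 = 2 * b.b0 * b.b1 + 3 * x₁ ^ 2 * B - x₁ ^ 3 * A
  coeff0 : a 0 = b.b0 ^ 2 - x₁ ^ 3 * B

theorem osculating_eval (a : Fin 5 → ℂ) (P : ℂ × ℂ) : (osculating a P).eval P.1 = P.2 :=
  tangent_eval _ _ _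

theorem osculating_slope (a : Fin 5 → ℂ) {P : ℂ × ℂ} (h : P.2 ≠ 0) :
    quartic' a P.1 = 2 * P.2 * (2 * (osculating a P).b2 * P.1 + (osculating a P).b1) :=
  (tangent_slope _ _ h).symm

theorem osculating_curvature (a : Fin 5 → ℂ) {P : ℂ × ℂ} (h : P.2 ≠ 0) :
    quartic'' a P.1 = 2 * (2 * (osculating a P).b2 * P.1 + (osculating a P).b1) ^ 2 +
      4 * P.2 * (osculating a P).b2 := by
  have h1 := osculating_slope a h
  have h2 : (osculating a P).b2 = quartic'' a P.1 / (4 * P.2) - quartic' a P.1 ^ 2 / (8 * P.2 ^ 3) :=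
    rfl
  generalize osculating a P = b at *
  rw [h1] at h2
  field_simp at h2
  linear_combination (-1 / 8 : ℂ) * h2

/-- `f - 𝒫²` vanishes at `x₁` with its first two derivatives. Here `b₂` is no longer a root of `a₄`,
so the quotient by `(x - x₁)³` has leading coefficient `a₄ - b₂²`. -/
theorem osculates_osculating {a : Fin 5 → ℂ} {P : ℂ × ℂ} (hP : OnCurve a P) (h : P.2 ≠ 0) :
    ∃ A B, A = a 4 - (osculating a P).b2 ^ 2 ∧ Osculates a (osculating a P) A B P.1 := by
  have h1 := osculating_eval a P
  have h2 := osculating_slope a h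
  have h3 := osculating_curvature a h
  generalize osculating a P = b at *
  obtain ⟨x, y⟩ := P
  simp only [OnCurve, quartic, quartic', quartic'', Parabola.eval] at *
  subst h1
  refine ⟨_, a 3 - 2 * b.b1 * b.b2 + 3 * x * (a 4 - b.b2 ^ 2), rfl, by ring, by ring, ?_, ?_, ?_⟩
  · linear_combination h3 / 2
  · linear_combination h2 - x * h3
  · linear_combination (-1 : ℂ) * hP - x * h2 + x ^ 2 / 2 * h3

theorem triplePoint_fst {a : Fin 5 → ℂ} {P : ℂ × ℂ} {A B : ℂ}
    (h : Osculates a (osculating a P) A B P.1) (hA : A ≠ 0) : A * (triplePoint a P).1 = -B := by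
  have e : a 4 - (osculating a P).b2 ^ 2 = A := by rw [h.coeff4]; ring
  simp only [triplePoint]
  rw [e, h.coeff3]
  field_simp
  ring

theorem triplePoint_snd (a : Fin 5 → ℂ) (P : ℂ × ℂ) :
    (triplePoint a P).2 = -(osculating a P).eval (triplePoint a P).1 := rfl

theorem onCurve_triplePoint {a : Fin 5 → ℂ} {P : ℂ × ℂ} {A B : ℂ}
    (h : Osculates a (osculating a P) A B P.1) (hA : A ≠ 0) : OnCurve a (triplePoint a P) := by
  have h1 := triplePoint_fst h hA
  rw [OnCurve, triplePoint_snd]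
  generalize (triplePoint a P).1 = x at *
  obtain rfl : B = -(A * x) := by rw [h1, neg_neg]
  simp only [quartic, Parabola.eval, h.coeff4, h.coeff3, h.coeff2, h.coeff1, h.coeff0]
  ring

/-- The velocity of `f''(x)`. -/
theorem Moves.quartic'' {a : ℝ → Fin 5 → ℂ} {P : ℝ → ℂ × ℂ} {μ : ℂ}
    (ha : ∀ i, HasDerivAt (fun t => a t i) 0 0) (hP : Moves a P μ) :
    HasDerivAt (fun t => quartic'' (a t) (P t).1)
      (μ * ((24 * a 0 4 * (P 0).1 + 6 * a 0 3) * (P 0).2)) 0 := by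
  have d := ((((ha 4).const_mul 12).mul (hP.fst.pow 2)).add
    (((ha 3).const_mul 6).mul hP.fst)).add ((ha 2).const_mul 2)
  refine d.congr_deriv ?_
  simp only [Pi.pow_apply]
  ring

/-- The cubic Taylor coefficient of `√f` at `x₁` is `(A x₁ + B) / (2y)`, because `f - 𝒫² = (A x +
B)(x - x₁)³`. The quadratic coefficient changes by three times this per unit of `x₁`, and `x₁' = μ
y`. -/
theorem hasDerivAt_osculatingCoeff {a : ℝ → Fin 5 → ℂ} {P : ℝ → ℂ × ℂ} {μ A B : ℂ}
    (ha : ∀ i, HasDerivAt (fun t => a t i) 0 0) (hP : Moves a P μ) (h : (P 0).2 ≠ 0)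
    (hI : Osculates (a 0) (osculating (a 0) (P 0)) A B (P 0).1) :
    HasDerivAt (fun t => osculatingCoeff (a t) (P t)) (3 / 2 * (A * (P 0).1 + B) * μ) 0 := by
  have h2 := osculating_slope (a 0) h
  have h3 := osculating_curvature (a 0) h
  have d := ((hP.quartic'' ha).div (hP.snd.const_mul 4) (mul_ne_zero (by norm_num) h)).sub
    (((hP.quartic' ha).pow 2).div ((hP.snd.pow 3).const_mul 8)
      (mul_ne_zero (by norm_num) (pow_ne_zero 3 h)))
  refine d.congr_deriv ?_
  simp only [Pi.pow_apply, h3, h2, hI.coeff4, hI.coeff3]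
  field_simp
  ring

/-- `𝒫` is the quadratic Taylor polynomial at a moving centre, so its time derivative is `σ (x -
x₁)²`. -/
theorem hasDerivAt_osculating {a : ℝ → Fin 5 → ℂ} {P : ℝ → ℂ × ℂ} {μ σ : ℂ}
    (ha : ∀ i, HasDerivAt (fun t => a t i) 0 0) (hP : Moves a P μ) (h : (P 0).2 ≠ 0)
    (hc : HasDerivAt (fun t => osculatingCoeff (a t) (P t)) σ 0) :
    HasDerivAt (fun t => (osculating (a t) (P t)).b1) (-2 * (P 0).1 * σ) 0 ∧
      HasDerivAt (fun t => (osculating (a t) (P t)).b0) ((P 0).1 ^ 2 * σ) 0 := by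
  have h2 := osculating_slope (a 0) h
  have h3 := osculating_curvature (a 0) h
  have hb : (osculating (a 0) (P 0)).b2 = osculatingCoeff (a 0) (P 0) := rfl
  rw [hb] at h2 h3
  have h2' : 2 * (P 0).2 ≠ 0 := mul_ne_zero two_ne_zero h
  have d1 := ((hP.quartic' ha).div (hP.snd.const_mul 2) h2').sub ((hc.const_mul 2).mul hP.fst)
  have d0 := ((hc.mul (hP.fst.pow 2)).sub
    ((hP.fst.mul (hP.quartic' ha)).div (hP.snd.const_mul 2) h2')).add hP.snd
  refine ⟨d1.congr_deriv ?_, d0.congr_deriv ?_⟩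
  all_goals
    clear d0 d1
    simp only [Pi.mul_apply, Pi.pow_apply, h3, h2]
    field_simp
    ring

/-- Differentiate `f - 𝒫² = (A x + B)(x - x₁)³` at the root `x₃`: the velocity `σ (x₃ - x₁)²` of
`𝒫`, with `σ = 3 A (x₁ - x₃) μ / 2`, gives `x₃' = -3 μ 𝒫(x₃)`. -/
theorem moves_triplePoint {a : ℝ → Fin 5 → ℂ} {P : ℝ → ℂ × ℂ} {μ A B : ℂ}
    (ha : ∀ i, HasDerivAt (fun t => a t i) 0 0) (hP : Moves a P μ) (h : (P 0).2 ≠ 0)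
    (hI : Osculates (a 0) (osculating (a 0) (P 0)) A B (P 0).1) (hA : A ≠ 0) :
    Moves a (fun t => triplePoint (a t) (P t)) (3 * μ) := by
  have h1 := osculating_eval (a 0) (P 0)
  have hx := triplePoint_fst hI hA
  have e : a 0 4 - (osculating (a 0) (P 0)).b2 ^ 2 = A := by rw [hI.coeff4]; ring
  have e' : a 0 4 - (osculating (a 0) (P 0)).b2 ^ 2 ≠ 0 := by rwa [e]
  have db2 : HasDerivAt (fun t => (osculating (a t) (P t)).b2) _ 0 :=
    hasDerivAt_osculatingCoeff ha hP h hI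
  obtain ⟨db1, db0⟩ := hasDerivAt_osculating ha hP h db2
  have dx : HasDerivAt (fun t => (triplePoint (a t) (P t)).1)
      (3 * μ * (triplePoint (a 0) (P 0)).2) 0 := by
    have d := (hP.fst.const_mul (-3)).sub
      (((ha 3).sub ((db1.const_mul 2).mul db2)).div ((ha 4).sub (db2.pow 2)) e')
    refine d.congr_deriv ?_
    simp only [Pi.sub_apply, Pi.mul_apply, Pi.pow_apply, e, triplePoint_snd]
    generalize (triplePoint (a 0) (P 0)).1 = x at *
    generalize osculating (a 0) (P 0) = b at *
    obtain rfl : B = -(A * x) := by rw [hx, neg_neg]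
    rw [← h1]
    simp only [hI.coeff3, Parabola.eval]
    field_simp
    ring
  refine ⟨onCurve_triplePoint hI hA, dx, ?_⟩
  have d := (((db2.mul (dx.pow 2)).add (db1.mul dx)).add db0).neg
  refine d.congr_deriv ?_
  simp only [Pi.pow_apply, triplePoint_snd]
  clear d dx
  generalize (triplePoint (a 0) (P 0)).1 = x at *
  generalize osculating (a 0) (P 0) = b at *
  obtain rfl : B = -(A * x) := by rw [hx, neg_neg]
  simp only [hI.coeff4, hI.coeff3, hI.coeff2, hI.coeff1, Parabola.eval, EulerSphere.quartic']
  ring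

/-! ### Motion of the multiples of a point -/

section Motion

variable {a : ℝ → Fin 5 → ℂ} {s : ℝ → ℂ} {P Q : ℝ → ℂ × ℂ} {μ μ₁ μ₂ : ℂ}

theorem moves_addPoint (ha : ∀ i, HasDerivAt (fun t => a t i) 0 0) (hs' : HasDerivAt s 0 0)
    (hs : s 0 ^ 2 = a 0 4) (hP : Moves a P μ₁) (hQ : Moves a Q μ₂)
    (h : AddDefined (a 0) (s 0) (P 0) (Q 0)) :
    Moves a (fun t => addPoint (a t) (s t) (P t) (Q t)) (μ₁ + μ₂) := by
  obtain ⟨A, B, hA, hI⟩ := intersects_chord hs hP.on hQ.on h.1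
  refine moves_thirdPoint (b := fun t => chord (s t) (P t) (Q t)) ha
    (x₁ := fun t => (P t).1) (x₂ := fun t => (Q t).1) ?_ ?_
    (parabolaMoves_chord hs' hP hQ h.1 hI) hI ?_
  · simpa only [chord_eval_left _ h.1] using hP.fst
  · simpa only [chord_eval_right _ h.1] using hQ.fst
  · rw [hA, ← neg_sub]
    exact neg_ne_zero.2 h.2

theorem moves_doublePoint (ha : ∀ i, HasDerivAt (fun t => a t i) 0 0) (hs' : HasDerivAt s 0 0)
    (hs : s 0 ^ 2 = a 0 4) (hP : Moves a P μ) (h : DoubleDefined (a 0) (s 0) (P 0)) :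
    Moves a (fun t => doublePoint (a t) (s t) (P t)) (μ + μ) := by
  obtain ⟨A, B, hA, hI⟩ := intersects_tangent hs hP.on h.1
  have h1 : HasDerivAt (fun t => (P t).1)
      (μ * (tangent (a 0) (s 0) (P 0)).eval (P 0).1) 0 := by
    simpa only [tangent_eval] using hP.fst
  refine moves_thirdPoint (b := fun t => tangent (a t) (s t) (P t)) ha
    (x₁ := fun t => (P t).1) (x₂ := fun t => (P t).1) h1 h1
    (parabolaMoves_tangent ha hs' hP h.1 hI) hI ?_
  rw [hA, ← neg_sub]
  exact neg_ne_zero.2 h.2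

theorem moves_mulPoint (rule : TriplingRule) (ha : ∀ i, HasDerivAt (fun t => a t i) 0 0)
    (hs' : HasDerivAt s 0 0) (hs : s 0 ^ 2 = a 0 4) (hP : Moves a P μ) :
    ∀ m : ℕ, MulDefined rule (a 0) (s 0) (P 0) m →
      Moves a (fun t => mulPoint rule (a t) (s t) (P t) m) (m * μ)
  | 0, h => h.elim
  | 1, _ => by simpa [mulPoint] using hP
  | 2, h => by
    have := moves_doublePoint ha hs' hs hP h
    rw [← two_mul] at this
    exact_mod_cast this
  | 3, h => by
    cases rule with
    | iterated =>
      have := moves_addPoint ha hs' hs (moves_doublePoint ha hs' hs hP h.1) hP h.2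
      rw [show μ + μ + μ = ((3 : ℕ) : ℂ) * μ by push_cast; ring] at this
      exact this
    | closed =>
      obtain ⟨A, B, hA, hI⟩ := osculates_osculating hP.on h.1
      have := moves_triplePoint ha hP h.1 hI (hA ▸ h.2)
      exact_mod_cast this
  | m + 4, h => by
    have := moves_addPoint ha hs' hs (moves_mulPoint rule ha hs' hs hP (m + 3) h.1) hP h.2
    rw [show ((m + 3 : ℕ) : ℂ) * μ + μ = ((m + 4 : ℕ) : ℂ) * μ by push_cast; ring] at this
    exact this

/-- Euler's theorem in infinitesimal form: only `μ₁ + μ₂` enters, since for a fixed curve `C`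
depends on the sum of the two points. If `A ≠ 0`, the cofactor is `-A L(x₃)`, where `L` is the
straight line through the points and `x₃ = -B / A`. -/
theorem hasDerivAt_eulerC {A B : ℂ} (ha : ∀ i, HasDerivAt (fun t => a t i) 0 0)
    (hs' : HasDerivAt s 0 0) (hP : Moves a P μ₁) (hQ : Moves a Q μ₂)
    (h : (P 0).1 ≠ (Q 0).1)
    (hI : Intersects (a 0) (chord (s 0) (P 0) (Q 0)) A B (P 0).1 (Q 0).1) :
    HasDerivAt (fun t => eulerC (a t) (P t) (Q t))
      ((μ₁ + μ₂) * (B * ((chord (s 0) (P 0) (Q 0)).b1 + s 0 * ((P 0).1 + (Q 0).1)) +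
        A * (s 0 * (P 0).1 * (Q 0).1 - (chord (s 0) (P 0) (Q 0)).b0))) 0 := by
  have h1 := chord_eval_left (s 0) h
  have h2 := chord_eval_right (s 0) h
  have hb : (chord (s 0) (P 0) (Q 0)).b2 = s 0 := rfl
  have hR : ∀ t, ((P t).2 - (Q t).2) / ((P t).1 - (Q t).1) =
      (chord (s t) (P t) (Q t)).b1 + s t * ((P t).1 + (Q t).1) := fun t => by
    simp only [chord]; ring
  have dS := hP.fst.add hQ.fst
  have dR := (parabolaMoves_chord hs' hP hQ h hI).b1.add (hs'.mul dS)
  have d := ((dR.pow 2).sub ((ha 4).mul (dS.pow 2))).sub ((ha 3).mul dS)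
  simp only [eulerC, hR]
  refine d.congr_deriv ?_
  simp only [Pi.add_apply, Pi.mul_apply, Pi.pow_apply, hI.coeff4, hI.coeff3]
  clear d dS dR hR
  generalize chord (s 0) (P 0) (Q 0) = b at *
  rw [← h1, ← h2, hb]
  simp only [Parabola.eval, hb]
  ring

/-! ### Nondegeneracy -/

theorem isNotSquare_of_root {c : Fin 5 → ℂ} {x : ℂ} (h : quartic c x = 0) (h' : quartic' c x ≠ 0) :
    IsNotSquare c := by
  intro b x₁ x₂ hI
  simp only [quartic, quartic', hI.coeff4, hI.coeff3, hI.coeff2, hI.coeff1, hI.coeff0] at h h'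
  have e : b.b2 * x ^ 2 + b.b1 * x + b.b0 = 0 := pow_eq_zero_iff two_ne_zero |>.1 <| by
    linear_combination h
  apply h'
  linear_combination 2 * (2 * b.b2 * x + b.b1) * e

/-- If `A = 0`, the derivative of the denominator is `b₂ B (μ₁ + μ₂)`; were it zero too, then `B =
0` and `f = 𝒫²`. -/
theorem ParabolaMoves.leading_ne_zero {b : ℝ → Parabola} {A B x₁ x₂ : ℂ}
    (ha : ∀ i, HasDerivAt (fun t => a t i) 0 0) (hsq : IsNotSquare (a 0))
    (hb : ParabolaMoves b A B x₁ x₂ μ₁ μ₂) (hI : Intersects (a 0) (b 0) A B x₁ x₂)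
    (hs : (b 0).b2 ≠ 0) (hμ : μ₁ + μ₂ ≠ 0)
    (hd : HasDerivAt (fun t => 2 * (b t).b1 * (b t).b2 - a t 3) 0 0) : A ≠ 0 := by
  rintro rfl
  have e := (((hb.b1.const_mul 2).mul hb.b2).sub (ha 3)).unique hd
  have e' : (b 0).b2 * (B * (μ₁ + μ₂)) = 0 := by linear_combination e
  obtain rfl : B = 0 := by simpa [hs, hμ] using e'
  exact hsq _ _ _ hI

/-- If the abscissas and their velocities agree, then `m y_Q = y_P`, while `y_Q² = y_P²` on the
curve; hence `m² = 1`. -/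
theorem Moves.fst_ne (hP : Moves a P μ) {m : ℂ} (hQ : Moves a Q (m * μ)) (hμ : μ ≠ 0)
    (hm : m ^ 2 ≠ 1) (hy : (P 0).2 ≠ 0)
    (hd : HasDerivAt (fun t => (Q t).1 - (P t).1) 0 0) : (Q 0).1 ≠ (P 0).1 := by
  intro hx
  have e := (hQ.fst.sub hP.fst).unique hd
  have e1 : μ * (m * (Q 0).2 - (P 0).2) = 0 := by linear_combination e
  have e2 : m * (Q 0).2 = (P 0).2 := by simpa [hμ, sub_eq_zero] using e1
  have e3 : (Q 0).2 ^ 2 = (P 0).2 ^ 2 := by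
    rw [hQ.on, hP.on, hx]
  apply hm
  have := pow_ne_zero 2 hy
  apply mul_right_cancel₀ this
  rw [one_mul]
  nth_rw 1 [← e3]
  rw [← mul_pow, e2]

/-- The counterpart for the closed tripling: if `A = 0`, then `b₂² = a₄ ≠ 0` and the derivative is
`-3 b₂ B μ`, so vanishing again gives `f = 𝒫²`. -/
theorem Osculates.leading_ne_zero {A B : ℂ} (ha : ∀ i, HasDerivAt (fun t => a t i) 0 0)
    (hsq : IsNotSquare (a 0)) (h4 : a 0 4 ≠ 0) (hP : Moves a P μ) (h : (P 0).2 ≠ 0)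
    (hI : Osculates (a 0) (osculating (a 0) (P 0)) A B (P 0).1) (hμ : μ ≠ 0)
    (hd : HasDerivAt (fun t => a t 4 - (osculating (a t) (P t)).b2 ^ 2) 0 0) : A ≠ 0 := by
  rintro rfl
  have db2 : HasDerivAt (fun t => (osculating (a t) (P t)).b2) _ 0 :=
    hasDerivAt_osculatingCoeff ha hP h hI
  have e := ((ha 4).sub (db2.pow 2)).unique hd
  have h4' := h4
  rw [hI.coeff4, add_zero] at h4'
  have h5 : (osculating (a 0) (P 0)).b2 ≠ 0 := fun h0 => h4' (by rw [h0]; ring)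
  have e' : (osculating (a 0) (P 0)).b2 * (B * μ) = 0 := by linear_combination -e / 3
  obtain rfl : B = 0 := by simpa [h5, hμ] using e'
  refine hsq (osculating (a 0) (P 0)) 0 0 ⟨?_, ?_, ?_, ?_, ?_⟩
  · linear_combination hI.coeff4
  · linear_combination hI.coeff3
  · linear_combination hI.coeff2
  · linear_combination hI.coeff1
  · linear_combination hI.coeff0

/-- All the roots of `f` are simple. -/
def IsSeparable (c : Fin 5 → ℂ) : Prop := ∀ x, quartic c x = 0 → quartic' c x ≠ 0

/-- A point with `y = 0` and `y' = μ f'(x) / 2 = 0` lies over a multiple root. -/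
theorem Moves.snd_ne_zero (hP : Moves a P μ) (hc : IsSeparable (a 0)) (hμ : μ ≠ 0)
    (hd : HasDerivAt (fun t => (P t).2) 0 0) : (P 0).2 ≠ 0 := by
  intro hy
  have e := hP.snd.unique hd
  have e1 : EulerSphere.quartic' (a 0) (P 0).1 = 0 := by simpa [hμ] using e
  refine hc _ ?_ e1
  rw [← hP.on, hy]
  ring

/-- A relation between two points and their sum, valid where `C` is stationary. -/
theorem stationary_of_sum_eq {c : Fin 5 → ℂ} {σ A B : ℂ} {p q : ℂ × ℂ}
    (hI : Intersects c (chord σ p q) A B p.1 q.1) (hA : A ≠ 0)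
    (h : B * ((chord σ p q).b1 + σ * (p.1 + q.1)) +
      A * (σ * p.1 * q.1 - (chord σ p q).b0) = 0) :
    (addPoint c σ p q).2 +
      σ * ((addPoint c σ p q).1 - p.1) * ((addPoint c σ p q).1 - q.1) = 0 := by
  have hx := thirdPoint_fst hI hA
  have hb : (chord σ p q).b2 = σ := rfl
  rw [addPoint, thirdPoint_snd]
  generalize (thirdPoint c (chord σ p q) p.1 q.1).1 = x at *
  generalize chord σ p q = b at *
  obtain rfl : B = -(A * x) := by rw [hx, neg_neg]
  -- Let `L` be the straight line through `p` and `q`. With `B = -A x₃` the hypothesis reads `A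
  -- L(x₃) = 0`, and the left side of the goal is `-L(x₃)`.
  apply mul_left_cancel₀ hA
  simp only [Parabola.eval, hb]
  linear_combination h

/-- The relation `h0` says that the line `L` through the two points vanishes at `x₃`. If it also
persists to first order while only the first point moves, then `y₃ = 0`, for otherwise `f` would be
a square. -/
theorem moving_sum_snd_eq_zero (ha : ∀ i, HasDerivAt (fun t => a t i) 0 0) (hs' : HasDerivAt s 0 0)
    (hs : s 0 ^ 2 = a 0 4) (hsq : IsNotSquare (a 0)) (hP : Moves a P μ)
    (hQ : Moves a Q 0) (hμ : μ ≠ 0) (h : AddDefined (a 0) (s 0) (P 0) (Q 0))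
    (h0 : (addPoint (a 0) (s 0) (P 0) (Q 0)).2 + s 0 *
      ((addPoint (a 0) (s 0) (P 0) (Q 0)).1 - (P 0).1) *
      ((addPoint (a 0) (s 0) (P 0) (Q 0)).1 - (Q 0).1) = 0)
    (hd : HasDerivAt (fun t => (addPoint (a t) (s t) (P t) (Q t)).2 + s t *
      ((addPoint (a t) (s t) (P t) (Q t)).1 - (P t).1) *
      ((addPoint (a t) (s t) (P t) (Q t)).1 - (Q t).1)) 0 0) :
    (addPoint (a 0) (s 0) (P 0) (Q 0)).2 = 0 := by
  obtain ⟨A, B, hA, hI⟩ := intersects_chord hs hP.on hQ.on h.1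
  have hA0 : A ≠ 0 := by
    rw [hA, ← neg_sub]
    exact neg_ne_zero.2 h.2
  have hT := moves_addPoint ha hs' hs hP hQ h
  have e := ((hT.snd.add ((hs'.mul (hT.fst.sub hP.fst)).mul (hT.fst.sub hQ.fst))).unique hd)
  have hx : A * (addPoint (a 0) (s 0) (P 0) (Q 0)).1 = -B := thirdPoint_fst hI hA0
  have hb : (chord (s 0) (P 0) (Q 0)).b2 = s 0 := rfl
  have h1 := chord_eval_left (s 0) h.1
  have hy : (addPoint (a 0) (s 0) (P 0) (Q 0)).2 =
    -(chord (s 0) (P 0) (Q 0)).eval (addPoint (a 0) (s 0) (P 0) (Q 0)).1 := rfl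
  clear hT hd hA
  simp only [Pi.sub_apply, Pi.mul_apply] at e
  generalize addPoint (a 0) (s 0) (P 0) (Q 0) = T at *
  obtain ⟨x₃, y₃⟩ := T
  generalize chord (s 0) (P 0) (Q 0) = b at *
  simp only at *
  obtain rfl : B = -(A * x₃) := by rw [hx, neg_neg]
  subst hy
  simp only [quartic', hI.coeff4, hI.coeff3, hI.coeff2, hI.coeff1, ← h1, Parabola.eval, hb] at e h0
  by_contra hy0
  rw [neg_eq_zero, Parabola.eval, hb] at hy0
  generalize s 0 = σ at *
  generalize (P 0).1 = x₁ at *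
  generalize (Q 0).1 = x₂ at *
  -- Modulo `h0` the velocity equation factors. The last factor is `A + 4 σ m`, where `m = b₁ + σ
  -- (x₁ + x₂)` is the slope of `L`.
  have key : μ * (σ * x₃ ^ 2 + b.b1 * x₃ + b.b0) *
      (4 * σ * b.b1 + A + 4 * σ ^ 2 * (x₁ + x₂)) = 0 := by
    linear_combination (2 * σ) * e - (A + 2 * σ * (σ * (x₁ + x₃) + b.b1)) * μ * h0
  obtain rfl : A = -4 * σ * (b.b1 + σ * (x₁ + x₂)) := by
    have := (mul_eq_zero.1 key).resolve_left (mul_ne_zero hμ hy0)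
    linear_combination this
  -- Put `S = σ (x - x₁)(x - x₂)`, so that `𝒫 = S + L` and `L = m (x - x₃)`. With `A = -4 σ m` one
  -- gets `f = (S + L)² - 4 S L = (S - L)²`; the witness is `S - L`.
  refine hsq ⟨σ * x₁ * x₂ + (b.b1 + σ * (x₁ + x₂)) * x₃, -(b.b1 + 2 * σ * (x₁ + x₂)), σ⟩ 0 0
    ⟨?_, ?_, ?_, ?_, ?_⟩
  · linear_combination hI.coeff4 + (b.b2 + σ) * hb
  · linear_combination hI.coeff3 + 2 * b.b1 * hb
  · linear_combination hI.coeff2 + 2 * b.b0 * hb - 2 * σ * h0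
  · linear_combination hI.coeff1 - 2 * b.b1 * h0
  · linear_combination hI.coeff0 - (b.b0 + σ * x₁ * x₂ - (b.b1 + σ * (x₁ + x₂)) * x₃) * h0

end Motion

/-! ### Smoothness of the operations -/

section Smooth

variable {E : Type*} [NormedAddCommGroup E] [NormedSpace ℝ E] {z : E}

theorem contDiffAt_div {f g : E → ℂ} (hf : ContDiffAt ℝ ∞ f z) (hg : ContDiffAt ℝ ∞ g z)
    (h : g z ≠ 0) : ContDiffAt ℝ ∞ (fun w => f w / g w) z := by
  simp only [div_eq_mul_inv]
  exact hf.mul (hg.inv h)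

variable {a : E → Fin 5 → ℂ} {s : E → ℂ} {P Q : E → ℂ × ℂ}

theorem contDiffAt_eval {b : E → Parabola} {x : E → ℂ} (h0 : ContDiffAt ℝ ∞ (fun w => (b w).b0) z)
    (h1 : ContDiffAt ℝ ∞ (fun w => (b w).b1) z) (h2 : ContDiffAt ℝ ∞ (fun w => (b w).b2) z)
    (hx : ContDiffAt ℝ ∞ x z) : ContDiffAt ℝ ∞ (fun w => (b w).eval (x w)) z :=
  ((h2.mul (hx.pow 2)).add (h1.mul hx)).add h0

theorem contDiffAt_thirdPoint {b : E → Parabola} {x₁ x₂ : E → ℂ}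
    (ha : ∀ i, ContDiffAt ℝ ∞ (fun w => a w i) z)
    (h0 : ContDiffAt ℝ ∞ (fun w => (b w).b0) z)
    (h1 : ContDiffAt ℝ ∞ (fun w => (b w).b1) z) (h2 : ContDiffAt ℝ ∞ (fun w => (b w).b2) z)
    (hx₁ : ContDiffAt ℝ ∞ x₁ z) (hx₂ : ContDiffAt ℝ ∞ x₂ z)
    (h : 2 * (b z).b1 * (b z).b2 - a z 3 ≠ 0) :
    ContDiffAt ℝ ∞ (fun w => thirdPoint (a w) (b w) (x₁ w) (x₂ w)) z := by
  have hx : ContDiffAt ℝ ∞ (fun w => (thirdPoint (a w) (b w) (x₁ w) (x₂ w)).1) z :=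
    (hx₁.neg.sub hx₂).sub (contDiffAt_div ((((contDiffAt_const.mul h0).mul h2).add
      (h1.pow 2)).sub (ha 2)) (((contDiffAt_const.mul h1).mul h2).sub (ha 3)) h)
  exact hx.prodMk (contDiffAt_eval h0 h1 h2 hx).neg

theorem contDiffAt_chord (hs : ContDiffAt ℝ ∞ s z) (hP : ContDiffAt ℝ ∞ P z)
    (hQ : ContDiffAt ℝ ∞ Q z) (h : (P z).1 ≠ (Q z).1) :
    ContDiffAt ℝ ∞ (fun w => (chord (s w) (P w) (Q w)).b0) z ∧
      ContDiffAt ℝ ∞ (fun w => (chord (s w) (P w) (Q w)).b1) z := by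
  have hx := (hP.fst.sub hQ.fst)
  have h' := sub_ne_zero.2 h
  exact ⟨((hs.mul hP.fst).mul hQ.fst).add
    (contDiffAt_div ((hP.fst.mul hQ.snd).sub (hQ.fst.mul hP.snd)) hx h'),
    (contDiffAt_div (hP.snd.sub hQ.snd) hx h').sub (hs.mul (hP.fst.add hQ.fst))⟩

theorem contDiffAt_quartic' (ha : ∀ i, ContDiffAt ℝ ∞ (fun w => a w i) z)
    (hP : ContDiffAt ℝ ∞ P z) : ContDiffAt ℝ ∞ (fun w => quartic' (a w) (P w).1) z :=
  ((((contDiffAt_const.mul (ha 4)).mul (hP.fst.pow 3)).add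
    ((contDiffAt_const.mul (ha 3)).mul (hP.fst.pow 2))).add
    ((contDiffAt_const.mul (ha 2)).mul hP.fst)).add (ha 1)

theorem contDiffAt_tangent (ha : ∀ i, ContDiffAt ℝ ∞ (fun w => a w i) z)
    (hs : ContDiffAt ℝ ∞ s z) (hP : ContDiffAt ℝ ∞ P z) (h : (P z).2 ≠ 0) :
    ContDiffAt ℝ ∞ (fun w => (tangent (a w) (s w) (P w)).b0) z ∧
      ContDiffAt ℝ ∞ (fun w => (tangent (a w) (s w) (P w)).b1) z := by
  have hq := contDiffAt_quartic' ha hP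
  have hy : ContDiffAt ℝ ∞ (fun w => 2 * (P w).2) z := contDiffAt_const.mul hP.snd
  have h' : 2 * (P z).2 ≠ 0 := mul_ne_zero two_ne_zero h
  exact ⟨((hs.mul (hP.fst.pow 2)).sub (contDiffAt_div (hP.fst.mul hq) hy h')).add hP.snd,
    (contDiffAt_div hq hy h').sub ((contDiffAt_const.mul hs).mul hP.fst)⟩

theorem contDiffAt_osculatingCoeff (ha : ∀ i, ContDiffAt ℝ ∞ (fun w => a w i) z)
    (hP : ContDiffAt ℝ ∞ P z) (h : (P z).2 ≠ 0) :
    ContDiffAt ℝ ∞ (fun w => osculatingCoeff (a w) (P w)) z := by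
  have hq := contDiffAt_quartic' ha hP
  have hq' : ContDiffAt ℝ ∞ (fun w => quartic'' (a w) (P w).1) z :=
    (((contDiffAt_const.mul (ha 4)).mul (hP.fst.pow 2)).add
      ((contDiffAt_const.mul (ha 3)).mul hP.fst)).add (contDiffAt_const.mul (ha 2))
  exact (contDiffAt_div hq' (contDiffAt_const.mul hP.snd) (mul_ne_zero (by norm_num) h)).sub
    (contDiffAt_div (hq.pow 2) (contDiffAt_const.mul (hP.snd.pow 3))
      (mul_ne_zero (by norm_num) (pow_ne_zero 3 h)))

theorem contDiffAt_addPoint (ha : ∀ i, ContDiffAt ℝ ∞ (fun w => a w i) z)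
    (hs : ContDiffAt ℝ ∞ s z) (hP : ContDiffAt ℝ ∞ P z) (hQ : ContDiffAt ℝ ∞ Q z)
    (h : AddDefined (a z) (s z) (P z) (Q z)) :
    ContDiffAt ℝ ∞ (fun w => addPoint (a w) (s w) (P w) (Q w)) z := by
  obtain ⟨h0, h1⟩ := contDiffAt_chord hs hP hQ h.1
  exact contDiffAt_thirdPoint ha h0 h1 hs hP.fst hQ.fst h.2

theorem eventually_ne_zero {f : E → ℂ} (hf : ContDiffAt ℝ ∞ f z) (h : f z ≠ 0) :
    ∀ᶠ w in nhds z, f w ≠ 0 :=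
  hf.continuousAt.eventually_ne h

theorem eventually_addDefined (ha : ∀ i, ContDiffAt ℝ ∞ (fun w => a w i) z)
    (hs : ContDiffAt ℝ ∞ s z) (hP : ContDiffAt ℝ ∞ P z) (hQ : ContDiffAt ℝ ∞ Q z)
    (h : AddDefined (a z) (s z) (P z) (Q z)) :
    ∀ᶠ w in nhds z, AddDefined (a w) (s w) (P w) (Q w) := by
  obtain ⟨-, h1⟩ := contDiffAt_chord hs hP hQ h.1
  filter_upwards [eventually_ne_zero (hP.fst.sub hQ.fst) (sub_ne_zero.2 h.1),
    eventually_ne_zero (((contDiffAt_const.mul h1).mul hs).sub (ha 3)) h.2] with w h1 h2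
  exact ⟨sub_ne_zero.1 h1, h2⟩

theorem contDiffAt_doublePoint (ha : ∀ i, ContDiffAt ℝ ∞ (fun w => a w i) z)
    (hs : ContDiffAt ℝ ∞ s z) (hP : ContDiffAt ℝ ∞ P z) (h : DoubleDefined (a z) (s z) (P z)) :
    ContDiffAt ℝ ∞ (fun w => doublePoint (a w) (s w) (P w)) z := by
  obtain ⟨h0, h1⟩ := contDiffAt_tangent ha hs hP h.1
  exact contDiffAt_thirdPoint ha h0 h1 hs hP.fst hP.fst h.2

theorem eventually_doubleDefined (ha : ∀ i, ContDiffAt ℝ ∞ (fun w => a w i) z)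
    (hs : ContDiffAt ℝ ∞ s z) (hP : ContDiffAt ℝ ∞ P z) (h : DoubleDefined (a z) (s z) (P z)) :
    ∀ᶠ w in nhds z, DoubleDefined (a w) (s w) (P w) := by
  obtain ⟨-, h1⟩ := contDiffAt_tangent ha hs hP h.1
  exact (eventually_ne_zero hP.snd h.1).and
    (eventually_ne_zero (((contDiffAt_const.mul h1).mul hs).sub (ha 3)) h.2)

theorem contDiffAt_triplePoint (ha : ∀ i, ContDiffAt ℝ ∞ (fun w => a w i) z)
    (hP : ContDiffAt ℝ ∞ P z) (h : TripleDefined (a z) (P z)) :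
    ContDiffAt ℝ ∞ (fun w => triplePoint (a w) (P w)) z := by
  have hc := contDiffAt_osculatingCoeff ha hP h.1
  obtain ⟨h0, h1⟩ := contDiffAt_tangent ha hc hP h.1
  have hx : ContDiffAt ℝ ∞ (fun w => (triplePoint (a w) (P w)).1) z :=
    (contDiffAt_const.mul hP.fst).sub (contDiffAt_div ((ha 3).sub
      ((contDiffAt_const.mul h1).mul hc)) ((ha 4).sub (hc.pow 2)) h.2)
  exact hx.prodMk (contDiffAt_eval (b := fun w => osculating (a w) (P w)) h0 h1 hc hx).neg

theorem eventually_tripleDefined (ha : ∀ i, ContDiffAt ℝ ∞ (fun w => a w i) z)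
    (hP : ContDiffAt ℝ ∞ P z) (h : TripleDefined (a z) (P z)) :
    ∀ᶠ w in nhds z, TripleDefined (a w) (P w) := by
  have hc := contDiffAt_osculatingCoeff ha hP h.1
  exact (eventually_ne_zero hP.snd h.1).and (eventually_ne_zero ((ha 4).sub (hc.pow 2)) h.2)

theorem contDiffAt_mulPoint (rule : TriplingRule) (ha : ∀ i, ContDiffAt ℝ ∞ (fun w => a w i) z)
    (hs : ContDiffAt ℝ ∞ s z) (hP : ContDiffAt ℝ ∞ P z) :
    ∀ m : ℕ, MulDefined rule (a z) (s z) (P z) m →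
      ContDiffAt ℝ ∞ (fun w => mulPoint rule (a w) (s w) (P w) m) z ∧
        ∀ᶠ w in nhds z, MulDefined rule (a w) (s w) (P w) m
  | 0, h => h.elim
  | 1, _ => ⟨hP, Filter.Eventually.of_forall fun _ => trivial⟩
  | 2, h => ⟨contDiffAt_doublePoint ha hs hP h, eventually_doubleDefined ha hs hP h⟩
  | 3, h => by
    cases rule with
    | iterated =>
      have hd := contDiffAt_doublePoint ha hs hP h.1
      exact ⟨contDiffAt_addPoint ha hs hd hP h.2,
        (eventually_doubleDefined ha hs hP h.1).and (eventually_addDefined ha hs hd hP h.2)⟩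
    | closed => exact ⟨contDiffAt_triplePoint ha hP h, eventually_tripleDefined ha hP h⟩
  | m + 4, h => by
    obtain ⟨hd, he⟩ := contDiffAt_mulPoint rule ha hs hP (m + 3) h.1
    exact ⟨contDiffAt_addPoint ha hs hd hP h.2, he.and (eventually_addDefined ha hs hd hP h.2)⟩

theorem contDiffAt_eulerC (ha : ∀ i, ContDiffAt ℝ ∞ (fun w => a w i) z)
    (hP : ContDiffAt ℝ ∞ P z) (hQ : ContDiffAt ℝ ∞ Q z) (h : (P z).1 ≠ (Q z).1) :
    ContDiffAt ℝ ∞ (fun w => eulerC (a w) (P w) (Q w)) z :=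
  (((contDiffAt_div (hP.snd.sub hQ.snd) (hP.fst.sub hQ.fst) (sub_ne_zero.2 h)).pow 2).sub
    ((ha 4).mul ((hP.fst.add hQ.fst).pow 2))).sub ((ha 3).mul (hP.fst.add hQ.fst))

end Smooth

/-! ### The integrals on the phase space -/

section Phase

variable {α : Fin 3 → ℝ} {k : Fin 2 → ℕ} {z : Phase}

/-- The derivative of `φ`. -/
def phi' (α : Fin 3 → ℝ) (x : ℝ) : ℝ :=
  (x - α 1) * (x - α 2) + (x - α 0) * (x - α 2) + (x - α 0) * (x - α 1)

theorem hasDerivAt_phi (α : Fin 3 → ℝ) (x : ℝ) : HasDerivAt (phi α) (phi' α x) x := by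
  have d := (((hasDerivAt_id x).sub_const (α 0)).mul ((hasDerivAt_id x).sub_const (α 1))).mul
    ((hasDerivAt_id x).sub_const (α 2))
  refine d.congr_deriv ?_
  simp only [phi', id, Pi.mul_apply]
  ring

/-- The value `φ(uᵢ) pᵢ² / kᵢ²` of `x I₁ + I₂` at `x = uᵢ`. -/
noncomputable def partialEnergy (α : Fin 3 → ℝ) (k : Fin 2 → ℕ) (z : Phase) (i : Fin 2) : ℝ :=
  phi α (z.1 i) * z.2 i ^ 2 / (k i : ℝ) ^ 2

theorem ham_eq (α : Fin 3 → ℝ) (k : Fin 2 → ℕ) (z : Phase) :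
    ham α k z = (partialEnergy α k z 0 - partialEnergy α k z 1) / (z.1 0 - z.1 1) := by
  simp [ham, metric, Fin.sum_univ_two, partialEnergy, phi]
  ring

theorem I₂_eq (α : Fin 3 → ℝ) (k : Fin 2 → ℕ) (z : Phase) :
    I₂ α k z = (z.1 0 * partialEnergy α k z 1 - z.1 1 * partialEnergy α k z 0) /
      (z.1 0 - z.1 1) := by
  have e : z.1 1 - z.1 0 = -(z.1 0 - z.1 1) := by ring
  simp only [I₂, partialEnergy, e, mul_neg, div_eq_mul_inv, mul_inv, inv_neg]
  ring

/-- Separation of variables: `x I₁ + I₂` is the linear interpolation of the two partial energies at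
`u₁`, `u₂`. -/
theorem partialEnergy_eq (h : z.1 0 ≠ z.1 1) (i : Fin 2) :
    partialEnergy α k z i = z.1 i * ham α k z + I₂ α k z := by
  have := sub_ne_zero.2 h
  rw [ham_eq, I₂_eq]
  fin_cases i <;> simp <;> field_simp <;> ring

theorem ne_of_mem_phaseSpace (hz : z ∈ phaseSpace α) : z.1 0 ≠ z.1 1 :=
  (hz.2.1.trans hz.2.2.1).ne

theorem isOpen_ellipticDomain (α : Fin 3 → ℝ) : IsOpen (ellipticDomain α) :=
  ((isOpen_lt continuous_const (continuous_apply 0)).inter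
    ((isOpen_lt (continuous_apply 0) continuous_const).inter
    ((isOpen_lt continuous_const (continuous_apply 1)).inter
      (isOpen_lt (continuous_apply 1) continuous_const))))

theorem isOpen_phaseSpace (α : Fin 3 → ℝ) : IsOpen (phaseSpace α) :=
  (isOpen_ellipticDomain α).preimage continuous_fst

theorem isOpen_slitPhaseSpace (α : Fin 3 → ℝ) : IsOpen (slitPhaseSpace α) :=
  (isOpen_phaseSpace α).inter (isOpen_ne_fun (by fun_prop) (by fun_prop))

/-! ### Signs of `φ`, the partial energies and `H` -/

theorem phi_pos (hz : z ∈ phaseSpace α) : 0 < phi α (z.1 0) := by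
  obtain ⟨h0, h1, h2, h3⟩ := hz
  exact mul_pos_of_neg_of_neg (mul_neg_of_pos_of_neg (by linarith) (by linarith)) (by linarith)

theorem phi_neg (hz : z ∈ phaseSpace α) : phi α (z.1 1) < 0 := by
  obtain ⟨h0, h1, h2, h3⟩ := hz
  exact mul_neg_of_pos_of_neg (mul_pos (by linarith) (by linarith)) (by linarith)

theorem phi_ne_zero (hz : z ∈ phaseSpace α) (i : Fin 2) : phi α (z.1 i) ≠ 0 := by
  fin_cases i
  · exact (phi_pos hz).ne'
  · exact (phi_neg hz).ne

theorem partialEnergy_zero_nonneg (hz : z ∈ phaseSpace α) : 0 ≤ partialEnergy α k z 0 := by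
  have := phi_pos hz
  unfold partialEnergy
  positivity

theorem partialEnergy_one_nonpos (hz : z ∈ phaseSpace α) : partialEnergy α k z 1 ≤ 0 :=
  div_nonpos_of_nonpos_of_nonneg
    (mul_nonpos_of_nonpos_of_nonneg (phi_neg hz).le (sq_nonneg _)) (sq_nonneg _)

theorem partialEnergy_ne_zero (hk : ∀ i, 0 < k i) (hz : z ∈ phaseSpace α) {i : Fin 2}
    (hp : z.2 i ≠ 0) : partialEnergy α k z i ≠ 0 := by
  have : (k i : ℝ) ≠ 0 := by exact_mod_cast (hk i).ne'
  have := phi_ne_zero hz i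
  unfold partialEnergy
  positivity

theorem ham_neg (hk : ∀ i, 0 < k i) (hz : z ∈ slitPhaseSpace α) : ham α k z < 0 := by
  have h0 := partialEnergy_zero_nonneg (k := k) hz.1
  have h1 := partialEnergy_one_nonpos (k := k) hz.1
  rw [ham_eq]
  refine div_neg_of_pos_of_neg ?_ (sub_neg.2 (hz.1.2.1.trans hz.1.2.2.1))
  by_contra hle
  have e0 : partialEnergy α k z 0 = 0 := by linarith
  have e1 : partialEnergy α k z 1 = 0 := by linarith
  apply hz.2
  ext i
  by_contra hp
  have := partialEnergy_ne_zero hk hz.1 hp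
  fin_cases i
  · exact this e0
  · exact this e1

/-! ### Derivatives along lines -/

theorem hasDerivAt_line_fst (z v : Phase) (i : Fin 2) :
    HasDerivAt (fun t : ℝ => (z + t • v).1 i) (v.1 i) 0 := by
  simpa using ((hasDerivAt_id (0 : ℝ)).mul_const (v.1 i)).const_add (z.1 i)

theorem hasDerivAt_line_snd (z v : Phase) (i : Fin 2) :
    HasDerivAt (fun t : ℝ => (z + t • v).2 i) (v.2 i) 0 := by
  simpa using ((hasDerivAt_id (0 : ℝ)).mul_const (v.2 i)).const_add (z.2 i)

theorem hasDerivAt_line {F : Phase → ℂ} (hF : DifferentiableAt ℝ F z) (v : Phase) :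
    HasDerivAt (fun t : ℝ => F (z + t • v)) (fderiv ℝ F z v) 0 :=
  hF.hasFDerivAt.hasLineDerivAt v

theorem hasDerivAt_line_phi (α : Fin 3 → ℝ) (z v : Phase) (i : Fin 2) :
    HasDerivAt (fun t : ℝ => phi α ((z + t • v).1 i)) (phi' α (z.1 i) * v.1 i) 0 := by
  have h : HasDerivAt (phi α) (phi' α (z.1 i)) ((z + (0 : ℝ) • v).1 i) := by
    simpa using hasDerivAt_phi α (z.1 i)
  exact HasDerivAt.comp (0 : ℝ) h (hasDerivAt_line_fst z v i)

/-- The derivative of `partialEnergy` in the direction `v`. -/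
noncomputable def partialEnergy' (α : Fin 3 → ℝ) (k : Fin 2 → ℕ) (z v : Phase) (i : Fin 2) : ℝ :=
  (phi' α (z.1 i) * v.1 i * z.2 i ^ 2 + phi α (z.1 i) * (2 * z.2 i * v.2 i)) / (k i : ℝ) ^ 2

theorem hasDerivAt_line_partialEnergy (α : Fin 3 → ℝ) (k : Fin 2 → ℕ) (z v : Phase) (i : Fin 2) :
    HasDerivAt (fun t : ℝ => partialEnergy α k (z + t • v) i) (partialEnergy' α k z v i) 0 := by
  have d := ((hasDerivAt_line_phi α z v i).mul ((hasDerivAt_line_snd z v i).pow 2)).div_const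
    ((k i : ℝ) ^ 2)
  refine d.congr_deriv ?_
  simp [partialEnergy']

theorem hasDerivAt_line_ham (h : z.1 0 ≠ z.1 1) (v : Phase) :
    HasDerivAt (fun t : ℝ => ham α k (z + t • v))
      ((partialEnergy' α k z v 0 - partialEnergy' α k z v 1 - ham α k z * (v.1 0 - v.1 1)) /
        (z.1 0 - z.1 1)) 0 := by
  have h' := sub_ne_zero.2 h
  have d := ((hasDerivAt_line_partialEnergy α k z v 0).sub
    (hasDerivAt_line_partialEnergy α k z v 1)).div
    ((hasDerivAt_line_fst z v 0).sub (hasDerivAt_line_fst z v 1)) (by simpa using h')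
  simp only [ham_eq]
  refine d.congr_deriv ?_
  simp only [Pi.sub_apply, zero_smul, add_zero]
  field_simp

theorem hasDerivAt_line_I₂ (h : z.1 0 ≠ z.1 1) (v : Phase) :
    HasDerivAt (fun t : ℝ => I₂ α k (z + t • v))
      ((v.1 0 * partialEnergy α k z 1 + z.1 0 * partialEnergy' α k z v 1 -
        v.1 1 * partialEnergy α k z 0 - z.1 1 * partialEnergy' α k z v 0 -
        I₂ α k z * (v.1 0 - v.1 1)) / (z.1 0 - z.1 1)) 0 := by
  have h' := sub_ne_zero.2 h
  have d := (((hasDerivAt_line_fst z v 0).mul (hasDerivAt_line_partialEnergy α k z v 1)).sub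
    ((hasDerivAt_line_fst z v 1).mul (hasDerivAt_line_partialEnergy α k z v 0))).div
    ((hasDerivAt_line_fst z v 0).sub (hasDerivAt_line_fst z v 1)) (by simpa using h')
  simp only [I₂_eq]
  refine d.congr_deriv ?_
  simp only [Pi.sub_apply, Pi.mul_apply, zero_smul, add_zero]
  field_simp
  ring

/-- The vector field tangent to the common level sets of `I₁` and `I₂` along which the point `Pᵢ`
moves with unit speed on the curve and the other point is at rest. -/
noncomputable def flowField (α : Fin 3 → ℝ) (k : Fin 2 → ℕ) (i : Fin 2) (z : Phase) : Phase :=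
  (Pi.single i (phi α (z.1 i) * z.2 i / k i),
    Pi.single i (k i * ham α k z / 2 - z.2 i ^ 2 * phi' α (z.1 i) / (2 * k i)))

/-- The momentum component of the field is chosen for this identity: it is what `Eⱼ = uⱼ I₁ + I₂`
gives when `I₁` and `I₂` are stationary. -/
theorem partialEnergy'_flowField (hk : ∀ i, 0 < k i) (i j : Fin 2) :
    partialEnergy' α k z (flowField α k i z) j = (flowField α k i z).1 j * ham α k z := by
  have h0 : (k 0 : ℝ) ≠ 0 := by exact_mod_cast (hk 0).ne'
  have h1 : (k 1 : ℝ) ≠ 0 := by exact_mod_cast (hk 1).ne'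
  fin_cases i <;> fin_cases j <;> simp [partialEnergy', flowField] <;> field_simp <;> ring

theorem hasDerivAt_flowField_ham (hk : ∀ i, 0 < k i) (h : z.1 0 ≠ z.1 1) (i : Fin 2) :
    HasDerivAt (fun t : ℝ => ham α k (z + t • flowField α k i z)) 0 0 := by
  refine (hasDerivAt_line_ham h _).congr_deriv ?_
  rw [partialEnergy'_flowField hk, partialEnergy'_flowField hk]
  ring

theorem hasDerivAt_flowField_I₂ (hk : ∀ i, 0 < k i) (h : z.1 0 ≠ z.1 1) (i : Fin 2) :
    HasDerivAt (fun t : ℝ => I₂ α k (z + t • flowField α k i z)) 0 0 := by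
  refine (hasDerivAt_line_I₂ h _).congr_deriv ?_
  rw [partialEnergy'_flowField hk, partialEnergy'_flowField hk, partialEnergy_eq h,
    partialEnergy_eq h]
  ring

theorem hasDerivAt_flowField_coeffs (hk : ∀ i, 0 < k i) (h : z.1 0 ≠ z.1 1) (i : Fin 2)
    (j : Fin 5) : HasDerivAt (fun t : ℝ => coeffs α k (z + t • flowField α k i z) j) 0 0 := by
  have d1 := hasDerivAt_flowField_ham (α := α) hk h i
  have d2 := hasDerivAt_flowField_I₂ (α := α) hk h i
  have key : ∀ c d : ℝ, HasDerivAt (fun t : ℝ =>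
      ((c * ham α k (z + t • flowField α k i z) + d * I₂ α k (z + t • flowField α k i z) : ℝ) : ℂ))
      0 0 := fun c d => by
    simpa using ((d1.const_mul c).add (d2.const_mul d)).ofReal_comp
  fin_cases j
  · refine (key 0 (-(α 0 * α 1 * α 2))).congr_of_eventuallyEq (.of_forall fun t => ?_)
    simp [coeffs]
  · refine (key (-(α 0 * α 1 * α 2)) (α 0 * α 1 + α 0 * α 2 + α 1 * α 2)).congr_of_eventuallyEq
      (.of_forall fun t => ?_)
    simp [coeffs]; ring
  · refine (key (α 0 * α 1 + α 0 * α 2 + α 1 * α 2) (-(α 0 + α 1 + α 2))).congr_of_eventuallyEq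
      (.of_forall fun t => ?_)
    simp [coeffs]; ring
  · refine (key (-(α 0 + α 1 + α 2)) 1).congr_of_eventuallyEq (.of_forall fun t => ?_)
    simp [coeffs]; ring
  · refine (key 1 0).congr_of_eventuallyEq (.of_forall fun t => ?_)
    simp [coeffs]

/-! ### The curve over a point of the phase space and the points `Pᵢ` on it -/

theorem quartic_coeffs (α : Fin 3 → ℝ) (k : Fin 2 → ℕ) (z : Phase) (x : ℂ) :
    quartic (coeffs α k z) x =
      (x - α 0) * (x - α 1) * (x - α 2) * (x * ham α k z + I₂ α k z) := by
  simp [quartic, coeffs]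
  ring

theorem quartic'_coeffs (α : Fin 3 → ℝ) (k : Fin 2 → ℕ) (z : Phase) (x : ℂ) :
    quartic' (coeffs α k z) x =
      ((x - α 1) * (x - α 2) + (x - α 0) * (x - α 2) + (x - α 0) * (x - α 1)) *
        (x * ham α k z + I₂ α k z) + (x - α 0) * (x - α 1) * (x - α 2) * ham α k z := by
  simp [quartic', coeffs]
  ring

theorem onCurve_divisorPoint (h : z.1 0 ≠ z.1 1) (i : Fin 2) :
    OnCurve (coeffs α k z) (divisorPoint α k z i) := by
  have e := partialEnergy_eq (α := α) (k := k) h i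
  rw [OnCurve, quartic_coeffs]
  simp only [divisorPoint]
  norm_cast
  rw [← e]
  simp only [partialEnergy, phi]
  ring

theorem moves_divisorPoint (hk : ∀ i, 0 < k i) (h : z.1 0 ≠ z.1 1) (i j : Fin 2) :
    Moves (fun t => coeffs α k (z + t • flowField α k i z))
      (fun t => divisorPoint α k (z + t • flowField α k i z) j) (if j = i then 1 else 0) := by
  have h0 : (k j : ℝ) ≠ 0 := by exact_mod_cast (hk j).ne'
  refine ⟨?_, ?_, ?_⟩
  · simpa using onCurve_divisorPoint h j
  · refine (hasDerivAt_line_fst z (flowField α k i z) j).ofReal_comp.congr_deriv ?_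
    by_cases hij : j = i
    · subst hij
      simp [flowField, divisorPoint]
    · simp [flowField, hij]
  · have d := (((hasDerivAt_line_phi α z (flowField α k i z) j).mul
      (hasDerivAt_line_snd z (flowField α k i z) j)).div_const (k j : ℝ)).ofReal_comp
    refine d.congr_deriv ?_
    by_cases hij : j = i
    · subst hij
      have e := partialEnergy_eq (α := α) (k := k) h j
      have key : (phi' α (z.1 j) * (phi α (z.1 j) * z.2 j / k j) * z.2 j + phi α (z.1 j) *
          (k j * ham α k z / 2 - z.2 j ^ 2 * phi' α (z.1 j) / (2 * k j))) / k j =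
          (phi' α (z.1 j) * (z.1 j * ham α k z + I₂ α k z) + phi α (z.1 j) * ham α k z) / 2 := by
        rw [← e, partialEnergy]
        field_simp
        ring
      have key' := congrArg (fun x : ℝ => (x : ℂ)) key
      simp only [zero_smul, add_zero, quartic'_coeffs, if_true, one_mul, flowField,
        Pi.single_eq_same, divisorPoint]
      rw [key']
      simp [phi, phi']
    · simp [flowField, hij]

/-! ### The Hamiltonian vector field -/

theorem contDiffAt_partialEnergy (α : Fin 3 → ℝ) (k : Fin 2 → ℕ) (z : Phase) (i : Fin 2) :
    ContDiffAt ℝ ∞ (fun w => partialEnergy α k w i) z := by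
  simp only [partialEnergy, phi]
  fun_prop

theorem contDiffAt_ham (h : z.1 0 ≠ z.1 1) : ContDiffAt ℝ ∞ (ham α k) z := by
  have : ham α k = fun w =>
    (partialEnergy α k w 0 - partialEnergy α k w 1) / (w.1 0 - w.1 1) := funext (ham_eq α k)
  rw [this]
  exact ((contDiffAt_partialEnergy α k z 0).sub (contDiffAt_partialEnergy α k z 1)).fun_div
    (by fun_prop) (sub_ne_zero.2 h)

theorem contDiffAt_I₂ (h : z.1 0 ≠ z.1 1) : ContDiffAt ℝ ∞ (I₂ α k) z := by
  have : I₂ α k = fun w => (w.1 0 * partialEnergy α k w 1 - w.1 1 * partialEnergy α k w 0) /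
    (w.1 0 - w.1 1) := funext (I₂_eq α k)
  rw [this]
  have h0 := contDiffAt_partialEnergy α k z 0
  have h1 := contDiffAt_partialEnergy α k z 1
  exact ContDiffAt.fun_div (by fun_prop) (by fun_prop) (sub_ne_zero.2 h)

theorem contDiffAt_ofReal {f : Phase → ℝ} (hf : ContDiffAt ℝ ∞ f z) :
    ContDiffAt ℝ ∞ (fun w => (f w : ℂ)) z :=
  Complex.ofRealCLM.contDiff.contDiffAt.comp z hf

theorem contDiffAt_coeffs (h : z.1 0 ≠ z.1 1) (j : Fin 5) :
    ContDiffAt ℝ ∞ (fun w => coeffs α k w j) z := by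
  have h1 := contDiffAt_ham (α := α) (k := k) h
  have h2 := contDiffAt_I₂ (α := α) (k := k) h
  fin_cases j <;> exact contDiffAt_ofReal (by fun_prop)

theorem contDiffAt_divisorPoint (α : Fin 3 → ℝ) (k : Fin 2 → ℕ) (z : Phase) (i : Fin 2) :
    ContDiffAt ℝ ∞ (fun w => divisorPoint α k w i) z := by
  refine (contDiffAt_ofReal ?_).prodMk (contDiffAt_ofReal ?_)
  · fun_prop
  · simp only [phi]
    fun_prop

theorem fderiv_ham (h : z.1 0 ≠ z.1 1) (v : Phase) :
    fderiv ℝ (fun w => (ham α k w : ℂ)) z v =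
      (((partialEnergy' α k z v 0 - partialEnergy' α k z v 1 - ham α k z * (v.1 0 - v.1 1)) /
        (z.1 0 - z.1 1) : ℝ) : ℂ) :=
  (hasDerivAt_line ((contDiffAt_ofReal (contDiffAt_ham h)).differentiableAt (by simp)) v).unique
    (hasDerivAt_line_ham h v).ofReal_comp

theorem fderiv_I₂ (h : z.1 0 ≠ z.1 1) (v : Phase) :
    fderiv ℝ (fun w => (I₂ α k w : ℂ)) z v =
      (((v.1 0 * partialEnergy α k z 1 + z.1 0 * partialEnergy' α k z v 1 -
        v.1 1 * partialEnergy α k z 0 - z.1 1 * partialEnergy' α k z v 0 -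
        I₂ α k z * (v.1 0 - v.1 1)) / (z.1 0 - z.1 1) : ℝ) : ℂ) :=
  (hasDerivAt_line ((contDiffAt_ofReal (contDiffAt_I₂ h)).differentiableAt (by simp)) v).unique
    (hasDerivAt_line_I₂ h v).ofReal_comp

theorem fderiv_flowField (F : Phase → ℂ) (i : Fin 2) :
    fderiv ℝ F z (flowField α k i z) =
      ((phi α (z.1 i) * z.2 i / k i : ℝ) : ℂ) * dU i F z +
        ((k i * ham α k z / 2 - z.2 i ^ 2 * phi' α (z.1 i) / (2 * k i) : ℝ) : ℂ) * dP i F z := by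
  have e : flowField α k i z = (phi α (z.1 i) * z.2 i / k i : ℝ) • ((Pi.single i 1, 0) : Phase) +
      (k i * ham α k z / 2 - z.2 i ^ 2 * phi' α (z.1 i) / (2 * k i) : ℝ) •
        ((0, Pi.single i 1) : Phase) := by
    simp [flowField, ← Pi.single_smul]
  rw [e, map_add, map_smul, map_smul, dU, dP, Complex.real_smul, Complex.real_smul]

/-- Hamilton's equations give `uᵢ' = ± 2 φ(uᵢ) pᵢ / (kᵢ² (u₁ - u₂))`, so the Hamiltonian field is `2
/ (u₁ - u₂)` times `X₀ / k₀ - X₁ / k₁`. The minus sign in front is that of the bracket convention.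
-/
theorem poissonBracket_ham (hk : ∀ i, 0 < k i) (h : z.1 0 ≠ z.1 1) (F : Phase → ℂ) :
    poissonBracket (fun w => (ham α k w : ℂ)) F z =
      -(2 / ((z.1 0 : ℂ) - z.1 1)) * (fderiv ℝ F z (flowField α k 0 z) / k 0 -
        fderiv ℝ F z (flowField α k 1 z) / k 1) := by
  have h0 : (k 0 : ℂ) ≠ 0 := by exact_mod_cast (hk 0).ne'
  have h1 : (k 1 : ℂ) ≠ 0 := by exact_mod_cast (hk 1).ne'
  have h2 : (z.1 0 : ℂ) - z.1 1 ≠ 0 := by exact_mod_cast sub_ne_zero.2 h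
  simp only [fderiv_flowField, poissonBracket, Fin.sum_univ_two]
  have hU : ∀ i, dU i (fun w => (ham α k w : ℂ)) z = _ := fun i => fderiv_ham h _
  have hP : ∀ i, dP i (fun w => (ham α k w : ℂ)) z = _ := fun i => fderiv_ham h _
  simp only [hU, hP]
  simp [partialEnergy']
  field_simp
  ring

end Phase

section Branch

variable {α : Fin 3 → ℝ} {k : Fin 2 → ℕ} {s : Phase → ℂ} {z : Phase}

/-! ### Branches of the square root -/

theorem ne_of_mem_slitPhaseSpace (hz : z ∈ slitPhaseSpace α) : z.1 0 ≠ z.1 1 :=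
  ne_of_mem_phaseSpace hz.1

/-- Off the zero section `H < 0`, so `i √(-H)` is a branch. -/
theorem exists_isSqrtBranch (hk : ∀ i, 0 < k i) : ∃ s, IsSqrtBranch α k s := by
  refine ⟨fun z => Complex.I * (Real.sqrt (-ham α k z) : ℂ), fun z hz => ?_, fun z hz => ?_⟩
  · have h := (contDiffAt_ham (α := α) (k := k) (ne_of_mem_slitPhaseSpace hz)).continuousAt
    have h' : ContinuousAt (fun z => (Real.sqrt (-ham α k z) : ℂ)) z :=
      Complex.continuous_ofReal.continuousAt.comp
        (Real.continuous_sqrt.continuousAt.comp h.neg)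
    exact (continuousAt_const.mul h').continuousWithinAt
  · rw [mul_pow, Complex.I_sq]
    have := Real.sq_sqrt (neg_nonneg.2 (ham_neg hk hz).le)
    rw [← Complex.ofReal_pow, this]
    push_cast
    ring

theorem IsSqrtBranch.ne_zero (hs : IsSqrtBranch α k s) (hk : ∀ i, 0 < k i)
    (hz : z ∈ slitPhaseSpace α) : s z ≠ 0 := by
  intro h
  have := hs.2 z hz
  rw [h, zero_pow two_ne_zero] at this
  exact (ham_neg hk hz).ne (by exact_mod_cast this.symm)

/-- Near `z` the branch equals `s(z) √(H / H(z))`, which is smooth because `H(z) ≠ 0`. By continuity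
`s(w) / s(z)` has positive real part, which excludes the opposite sign. -/
theorem IsSqrtBranch.contDiffAt (hs : IsSqrtBranch α k s) (hk : ∀ i, 0 < k i)
    (hz : z ∈ slitPhaseSpace α) : ContDiffAt ℝ ∞ s z := by
  have h0 := hs.ne_zero hk hz
  have hH := ham_neg hk hz
  have hnhds := (isOpen_slitPhaseSpace α).mem_nhds hz
  have hc : ContinuousAt s z := hs.1.continuousAt hnhds
  have hr : ContDiffAt ℝ ∞ (fun w => ham α k w / ham α k z) z :=
    (contDiffAt_ham (ne_of_mem_slitPhaseSpace hz)).div_const _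
  have hsm : ContDiffAt ℝ ∞ (fun w => s z * (Real.sqrt (ham α k w / ham α k z) : ℂ)) z :=
    contDiffAt_const.mul (contDiffAt_ofReal (hr.sqrt (by rw [div_self hH.ne]; exact one_ne_zero)))
  refine hsm.congr_of_eventuallyEq ?_
  have hre : ContinuousAt (fun w => (s w / s z).re) z :=
    Complex.continuous_re.continuousAt.comp (hc.div_const _)
  have hpos : ∀ᶠ w in nhds z, 0 < (s w / s z).re :=
    hre.eventually (lt_mem_nhds (by simp [h0]))
  filter_upwards [hnhds, hpos] with w hw hwp
  have hq : (s w / s z) ^ 2 = ((Real.sqrt (ham α k w / ham α k z) : ℝ) : ℂ) ^ 2 := by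
    rw [div_pow, hs.2 w hw, hs.2 z hz, ← Complex.ofReal_pow,
      Real.sq_sqrt (div_pos_of_neg_of_neg (ham_neg hk hw) hH).le]
    push_cast
    rfl
  rcases sq_eq_sq_iff_eq_or_eq_neg.1 hq with h | h
  · rw [← h]
    field_simp
  · rw [h, Complex.neg_re, Complex.ofReal_re] at hwp
    linarith [Real.sqrt_nonneg (ham α k w / ham α k z)]

theorem eventually_line_mem {W : Set Phase} (hW : IsOpen W) (hz : z ∈ W) (v : Phase) :
    ∀ᶠ t : ℝ in nhds 0, z + t • v ∈ W := by
  have : Continuous fun t : ℝ => z + t • v := by fun_prop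
  exact this.continuousAt.eventually_mem (hW.mem_nhds (by simpa using hz))

theorem IsSqrtBranch.hasDerivAt_flowField (hs : IsSqrtBranch α k s) (hk : ∀ i, 0 < k i)
    (hz : z ∈ slitPhaseSpace α) (i : Fin 2) :
    HasDerivAt (fun t : ℝ => s (z + t • flowField α k i z)) 0 0 := by
  have d := hasDerivAt_line ((hs.contDiffAt hk hz).differentiableAt (by simp)) (flowField α k i z)
  have d1 := d.pow 2
  have d2 := (hasDerivAt_flowField_ham (α := α) hk (ne_of_mem_slitPhaseSpace hz) i).ofReal_comp
  have d3 := d1.congr_of_eventuallyEq (f₁ := fun t : ℝ => (ham α k (z + t • flowField α k i z) : ℂ))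
    (by
      filter_upwards [eventually_line_mem (isOpen_slitPhaseSpace α) hz (flowField α k i z)]
        with t ht
      exact (hs.2 _ ht).symm)
  have e := d3.unique d2
  have h0 := hs.ne_zero hk hz
  simp [h0] at e
  rwa [e] at d

theorem IsSqrtBranch.sq_eq_coeffs (hs : IsSqrtBranch α k s) (hz : z ∈ slitPhaseSpace α) :
    s z ^ 2 = coeffs α k z 4 := by
  rw [hs.2 z hz]
  simp [coeffs]

/-! ### Functions vanishing on open sets -/

/-- A function that vanishes on all of `W` has zero derivatives along all lines there, so `h` may
assume stationarity when proving `F z ≠ 0`. This lets first-order computations replace an argument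
by analytic continuation. -/
theorem exists_isOpen_ne_zero {F : Phase → ℂ} {W : Set Phase} (hW : IsOpen W) (hne : W.Nonempty)
    (hF : ∀ z ∈ W, ContDiffAt ℝ ∞ F z)
    (h : ∀ z ∈ W, (∀ v, HasDerivAt (fun t : ℝ => F (z + t • v)) 0 0) → F z ≠ 0) :
    ∃ W' ⊆ W, IsOpen W' ∧ W'.Nonempty ∧ ∀ z ∈ W', F z ≠ 0 := by
  refine ⟨{z | z ∈ W ∧ F z ≠ 0}, fun z hz => hz.1, ?_, ?_, fun z hz => hz.2⟩
  · refine isOpen_iff_mem_nhds.2 fun z hz => ?_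
    exact Filter.inter_mem (hW.mem_nhds hz.1) (eventually_ne_zero (hF z hz.1) hz.2)
  · by_contra hemp
    have h0 : ∀ z ∈ W, F z = 0 := fun z hz => by
      by_contra hz0
      exact hemp ⟨z, hz, hz0⟩
    obtain ⟨z, hz⟩ := hne
    refine h z hz (fun v => ?_) (h0 z hz)
    refine (hasDerivAt_const (0 : ℝ) (0 : ℂ)).congr_of_eventuallyEq ?_
    filter_upwards [eventually_line_mem hW hz v] with t ht
    exact h0 _ ht

/-- The points of the phase space with nonzero momenta over which the curve is nonsingular. -/
def nonsingularSet (α : Fin 3 → ℝ) (k : Fin 2 → ℕ) : Set Phase :=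
  {z | z ∈ phaseSpace α ∧ (∀ i, z.2 i ≠ 0) ∧ α 1 * ham α k z + I₂ α k z ≠ 0}

theorem nonsingularSet_subset : nonsingularSet α k ⊆ slitPhaseSpace α := fun z hz =>
  ⟨hz.1, fun h => hz.2.1 0 (by rw [h]; rfl)⟩

/-- The only nonlinear condition, `α₂ I₁ + I₂ ≠ 0`, is generic because the derivative of the left
side in `p₁` is a nonzero multiple of `(α₂ - u₂) φ(u₁) p₁`. -/
theorem exists_nonsingular (hk : ∀ i, 0 < k i) {W : Set Phase} (hW : IsOpen W) (hne : W.Nonempty)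
    (hWs : W ⊆ phaseSpace α) :
    ∃ W' ⊆ W, IsOpen W' ∧ W'.Nonempty ∧ W' ⊆ nonsingularSet α k := by
  have hp : ∀ i, ∀ V : Set Phase, IsOpen V → V.Nonempty →
      ∃ V' ⊆ V, IsOpen V' ∧ V'.Nonempty ∧ ∀ z ∈ V', (z.2 i : ℂ) ≠ 0 := fun i V hV hVne => by
    refine exists_isOpen_ne_zero (F := fun z => (z.2 i : ℂ)) hV hVne
      (fun z _ => contDiffAt_ofReal (by fun_prop)) fun z _ hd => ?_
    have := (hd (0, Pi.single i 1)).unique (hasDerivAt_line_snd z _ i).ofReal_comp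
    simp at this
  obtain ⟨W₀, s₀, o₀, n₀, h₀⟩ := hp 0 W hW hne
  obtain ⟨W₁, s₁, o₁, n₁, h₁⟩ := hp 1 W₀ o₀ n₀
  have hsub : ∀ z ∈ W₁, z ∈ phaseSpace α := fun z hz => hWs (s₀ (s₁ hz))
  obtain ⟨W₂, s₂, o₂, n₂, h₂⟩ := exists_isOpen_ne_zero
    (F := fun z => ((α 1 * ham α k z + I₂ α k z : ℝ) : ℂ)) o₁ n₁
    (fun z hz => contDiffAt_ofReal ((contDiffAt_const.mul
      (contDiffAt_ham (ne_of_mem_phaseSpace (hsub z hz)))).add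
      (contDiffAt_I₂ (ne_of_mem_phaseSpace (hsub z hz))))) fun z hz hd => by
    exfalso
    have hne := ne_of_mem_phaseSpace (hsub z hz)
    have e := (hd (0, Pi.single 0 1)).unique ((((hasDerivAt_line_ham hne _).const_mul (α 1)).add
      (hasDerivAt_line_I₂ hne _)).ofReal_comp)
    have hk0 : (k 0 : ℝ) ≠ 0 := by exact_mod_cast (hk 0).ne'
    have hp0 : z.2 0 ≠ 0 := by exact_mod_cast h₀ z (s₁ hz)
    have hphi := phi_ne_zero (hsub z hz) 0
    have hu := sub_ne_zero.2 hne
    have hα : α 1 - z.1 1 ≠ 0 := (sub_neg.2 (hsub z hz).2.2.1).ne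
    have e' : (0 : ℝ) = (α 1 - z.1 1) * (phi α (z.1 0) * (2 * z.2 0) / (k 0 : ℝ) ^ 2) /
        (z.1 0 - z.1 1) := by
      have e1 := Complex.ofReal_injective (Complex.ofReal_zero.trans e)
      rw [e1]
      simp [partialEnergy']
      ring
    have : (α 1 - z.1 1) * (phi α (z.1 0) * (2 * z.2 0) / (k 0 : ℝ) ^ 2) / (z.1 0 - z.1 1) ≠ 0 := by
      positivity
    exact this e'.symm
  refine ⟨W₂, s₂.trans (s₁.trans s₀), o₂, n₂, fun z hz => ⟨hsub z (s₂ hz), ?_, ?_⟩⟩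
  · intro i
    fin_cases i
    · exact_mod_cast h₀ z (s₁ (s₂ hz))
    · exact_mod_cast h₁ z (s₂ hz)
  · exact_mod_cast h₂ z hz

theorem isSeparable_coeffs (hα : StrictMono α) (hk : ∀ i, 0 < k i) (hz : z ∈ nonsingularSet α k) :
    IsSeparable (coeffs α k z) := by
  have hH := ham_neg hk (nonsingularSet_subset hz)
  have h01 : α 0 < α 1 := hα (by decide)
  have h12 : α 1 < α 2 := hα (by decide)
  have e0 := partialEnergy_eq (α := α) (k := k) (ne_of_mem_phaseSpace hz.1) 0
  have e1 := partialEnergy_eq (α := α) (k := k) (ne_of_mem_phaseSpace hz.1) 1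
  have p0 := partialEnergy_zero_nonneg (k := k) hz.1
  have p1 := partialEnergy_one_nonpos (k := k) hz.1
  obtain ⟨hu, -, hα1⟩ := hz
  obtain ⟨u0, u1, u2, u3⟩ := hu
  -- The line `x H + I₂` is decreasing, nonnegative at `u₁` and nonpositive at `u₂`. Hence it is
  -- positive at `α₁` and negative at `α₃`; only `α₂` had to be excluded by hypothesis.
  have hα0 : α 0 * ham α k z + I₂ α k z ≠ 0 := by
    have := mul_lt_mul_of_neg_right u0 hH
    linarith
  have hα2 : α 2 * ham α k z + I₂ α k z ≠ 0 := by
    have := mul_lt_mul_of_neg_right u3 hH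
    linarith
  intro x hx
  rw [quartic_coeffs] at hx
  rw [quartic'_coeffs]
  have n01 : (α 0 : ℂ) - α 1 ≠ 0 := by exact_mod_cast (sub_neg.2 h01).ne
  have n02 : (α 0 : ℂ) - α 2 ≠ 0 := by exact_mod_cast (sub_neg.2 (h01.trans h12)).ne
  have n12 : (α 1 : ℂ) - α 2 ≠ 0 := by exact_mod_cast (sub_neg.2 h12).ne
  have n10 : (α 1 : ℂ) - α 0 ≠ 0 := by exact_mod_cast (sub_pos.2 h01).ne'
  have n20 : (α 2 : ℂ) - α 0 ≠ 0 := by exact_mod_cast (sub_pos.2 (h01.trans h12)).ne'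
  have n21 : (α 2 : ℂ) - α 1 ≠ 0 := by exact_mod_cast (sub_pos.2 h12).ne'
  have c0 : (α 0 : ℂ) * ham α k z + I₂ α k z ≠ 0 := by exact_mod_cast hα0
  have c1 : (α 1 : ℂ) * ham α k z + I₂ α k z ≠ 0 := by exact_mod_cast hα1
  have c2 : (α 2 : ℂ) * ham α k z + I₂ α k z ≠ 0 := by exact_mod_cast hα2
  have cH : (ham α k z : ℂ) ≠ 0 := by exact_mod_cast hH.ne
  by_cases hx0 : x - α 0 = 0
  · obtain rfl := sub_eq_zero.1 hx0
    simp [n01, n02, c0]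
  by_cases hx1 : x - α 1 = 0
  · obtain rfl := sub_eq_zero.1 hx1
    simp [n10, n12, c1]
  by_cases hx2 : x - α 2 = 0
  · obtain rfl := sub_eq_zero.1 hx2
    simp [n20, n21, c2]
  have hx3 : x * (ham α k z : ℂ) + I₂ α k z = 0 := by simpa [hx0, hx1, hx2] using hx
  rw [hx3]
  simp [hx0, hx1, hx2, cH]

theorem isNotSquare_coeffs (hα : StrictMono α) (hk : ∀ i, 0 < k i) (hz : z ∈ nonsingularSet α k) :
    IsNotSquare (coeffs α k z) := by
  have h : quartic (coeffs α k z) (α 0) = 0 := by simp [quartic_coeffs]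
  exact isNotSquare_of_root h (isSeparable_coeffs hα hk hz _ h)

end Branch

section Regular

variable {α : Fin 3 → ℝ} {k : Fin 2 → ℕ} {s : Phase → ℂ} {z : Phase} {rule : TriplingRule}

/-! ### Denominators do not vanish on open sets -/

/-- The function `Q` of points of the phase space is smooth at `z`, and along `flowField α k i` the
point `Q z` moves on the curve with the speed `μ`. -/
structure MovesAt (α : Fin 3 → ℝ) (k : Fin 2 → ℕ) (i : Fin 2) (Q : Phase → ℂ × ℂ) (μ : ℂ)
    (z : Phase) : Prop where
  smooth : ContDiffAt ℝ ∞ Q z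
  moves : Moves (fun t => coeffs α k (z + t • flowField α k i z))
    (fun t => Q (z + t • flowField α k i z)) μ

theorem movesAt_divisorPoint (hk : ∀ i, 0 < k i) (h : z.1 0 ≠ z.1 1) (i j : Fin 2) :
    MovesAt α k i (fun w => divisorPoint α k w j) (if j = i then 1 else 0) z :=
  ⟨contDiffAt_divisorPoint α k z j, moves_divisorPoint hk h i j⟩

theorem MovesAt.addPoint {i : Fin 2} {P Q : Phase → ℂ × ℂ} {μ₁ μ₂ : ℂ} (hk : ∀ i, 0 < k i)
    (hs : IsSqrtBranch α k s) (hz : z ∈ slitPhaseSpace α) (hP : MovesAt α k i P μ₁ z)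
    (hQ : MovesAt α k i Q μ₂ z) (h : AddDefined (coeffs α k z) (s z) (P z) (Q z)) :
    MovesAt α k i (fun w => addPoint (coeffs α k w) (s w) (P w) (Q w)) (μ₁ + μ₂) z :=
  ⟨contDiffAt_addPoint (contDiffAt_coeffs (ne_of_mem_slitPhaseSpace hz)) (hs.contDiffAt hk hz)
    hP.smooth hQ.smooth h,
  moves_addPoint (hasDerivAt_flowField_coeffs hk (ne_of_mem_slitPhaseSpace hz) i)
    (hs.hasDerivAt_flowField hk hz i) (by simpa using hs.sq_eq_coeffs hz) hP.moves hQ.moves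
    (by simpa using h)⟩

theorem movesAt_mulPoint (hk : ∀ i, 0 < k i) (hs : IsSqrtBranch α k s)
    (hz : z ∈ slitPhaseSpace α) (i j : Fin 2) {m : ℕ}
    (h : MulDefined rule (coeffs α k z) (s z) (divisorPoint α k z j) m) :
    MovesAt α k i (fun w => mulPoint rule (coeffs α k w) (s w) (divisorPoint α k w j) m)
      (m * if j = i then 1 else 0) z :=
  ⟨(contDiffAt_mulPoint rule (contDiffAt_coeffs (ne_of_mem_slitPhaseSpace hz))
    (hs.contDiffAt hk hz) (contDiffAt_divisorPoint α k z j) m h).1,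
  moves_mulPoint rule (hasDerivAt_flowField_coeffs hk (ne_of_mem_slitPhaseSpace hz) i)
    (hs.hasDerivAt_flowField hk hz i) (by simpa using hs.sq_eq_coeffs hz)
    (moves_divisorPoint hk (ne_of_mem_slitPhaseSpace hz) i j) m (by simpa using h)⟩

theorem movesAt_multiple (hk : ∀ i, 0 < k i) (hs : IsSqrtBranch α k s)
    (hz : z ∈ slitPhaseSpace α) (i j : Fin 2)
    (h : MulDefined rule (coeffs α k z) (s z) (divisorPoint α k z j) (k j)) :
    MovesAt α k i (fun w => multiple rule α k s w j) (k j * if j = i then 1 else 0) z :=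
  movesAt_mulPoint hk hs hz i j h

theorem snd_divisorPoint_ne_zero (hk : ∀ i, 0 < k i) (hz : z ∈ nonsingularSet α k) (i : Fin 2) :
    (divisorPoint α k z i).2 ≠ 0 := by
  have h1 : (k i : ℝ) ≠ 0 := by exact_mod_cast (hk i).ne'
  have h2 := phi_ne_zero hz.1 i
  have h3 := hz.2.1 i
  have : phi α (z.1 i) * z.2 i / (k i : ℝ) ≠ 0 := by positivity
  exact Complex.ofReal_ne_zero.2 this

theorem exists_chord_finite (hα : StrictMono α) (hk : ∀ i, 0 < k i) (hs : IsSqrtBranch α k s)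
    {i : Fin 2} {P Q : Phase → ℂ × ℂ} {μ₁ μ₂ : ℂ} (hμ : μ₁ + μ₂ ≠ 0) {W : Set Phase}
    (hW : IsOpen W) (hne : W.Nonempty) (hWn : W ⊆ nonsingularSet α k)
    (hP : ∀ z ∈ W, MovesAt α k i P μ₁ z) (hQ : ∀ z ∈ W, MovesAt α k i Q μ₂ z)
    (h : ∀ z ∈ W, (P z).1 ≠ (Q z).1) :
    ∃ W' ⊆ W, IsOpen W' ∧ W'.Nonempty ∧
      ∀ z ∈ W', AddDefined (coeffs α k z) (s z) (P z) (Q z) := by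
  have hslit : W ⊆ slitPhaseSpace α := hWn.trans nonsingularSet_subset
  obtain ⟨W', s', o', n', h'⟩ := exists_isOpen_ne_zero
    (F := fun z => 2 * (chord (s z) (P z) (Q z)).b1 * (chord (s z) (P z) (Q z)).b2 -
      coeffs α k z 3) hW hne (fun z hz => by
        have hsm := hs.contDiffAt hk (hslit hz)
        exact ((contDiffAt_const.mul (contDiffAt_chord hsm (hP z hz).smooth (hQ z hz).smooth
          (h z hz)).2).mul hsm).sub (contDiffAt_coeffs (ne_of_mem_slitPhaseSpace (hslit hz)) 3))
    (fun z hz hd => by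
      have hz' := hslit hz
      have hOP : OnCurve (coeffs α k z) (P z) := by simpa using (hP z hz).moves.on
      have hOQ : OnCurve (coeffs α k z) (Q z) := by simpa using (hQ z hz).moves.on
      obtain ⟨A, B, hA, hI⟩ := intersects_chord (hs.sq_eq_coeffs hz') hOP hOQ (h z hz)
      have hb := parabolaMoves_chord (A := A) (B := B) (hs.hasDerivAt_flowField hk hz' i)
        (hP z hz).moves (hQ z hz).moves (by simpa using h z hz) (by simpa using hI)
      have := hb.leading_ne_zero (hasDerivAt_flowField_coeffs hk (ne_of_mem_slitPhaseSpace hz') i)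
        (by simpa using isNotSquare_coeffs hα hk (hWn hz)) (by simpa using hI)
        (by simpa [chord] using hs.ne_zero hk hz') hμ (hd _)
      rw [← neg_ne_zero, neg_sub, ← hA]
      exact this)
  exact ⟨W', s', o', n', fun z hz => ⟨h z (s' hz), h' z hz⟩⟩

theorem exists_doubleDefined (hα : StrictMono α) (hk : ∀ i, 0 < k i) (hs : IsSqrtBranch α k s)
    (i : Fin 2) {W : Set Phase} (hW : IsOpen W) (hne : W.Nonempty) (hWn : W ⊆ nonsingularSet α k) :
    ∃ W' ⊆ W, IsOpen W' ∧ W'.Nonempty ∧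
      ∀ z ∈ W', DoubleDefined (coeffs α k z) (s z) (divisorPoint α k z i) := by
  have hslit : W ⊆ slitPhaseSpace α := hWn.trans nonsingularSet_subset
  obtain ⟨W', s', o', n', h'⟩ := exists_isOpen_ne_zero
    (F := fun z => 2 * (tangent (coeffs α k z) (s z) (divisorPoint α k z i)).b1 *
      (tangent (coeffs α k z) (s z) (divisorPoint α k z i)).b2 - coeffs α k z 3) hW hne
    (fun z hz => by
      have hsm := hs.contDiffAt hk (hslit hz)
      have ha := contDiffAt_coeffs (α := α) (k := k) (ne_of_mem_slitPhaseSpace (hslit hz))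
      exact ((contDiffAt_const.mul (contDiffAt_tangent ha hsm (contDiffAt_divisorPoint α k z i)
        (snd_divisorPoint_ne_zero hk (hWn hz) i)).2).mul hsm).sub (ha 3))
    (fun z hz hd => by
      have hz' := hslit hz
      have hz0 := ne_of_mem_slitPhaseSpace hz'
      have hy := snd_divisorPoint_ne_zero hk (hWn hz) i
      have hP := (moves_divisorPoint (α := α) hk hz0 i i)
      rw [if_pos rfl] at hP
      obtain ⟨A, B, hA, hI⟩ := intersects_tangent (hs.sq_eq_coeffs hz')
        (onCurve_divisorPoint hz0 i) hy
      have ha := hasDerivAt_flowField_coeffs (α := α) hk hz0 i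
      have hb := parabolaMoves_tangent (A := A) (B := B) ha
        (hs.hasDerivAt_flowField hk hz' i) hP (by simpa using hy) (by simpa using hI)
      have := hb.leading_ne_zero ha
        (by simpa using isNotSquare_coeffs hα hk (hWn hz)) (by simpa using hI)
        (by simpa [tangent] using hs.ne_zero hk hz') (by norm_num) (hd _)
      rw [← neg_ne_zero, neg_sub, ← hA]
      exact this)
  exact ⟨W', s', o', n', fun z hz => ⟨snd_divisorPoint_ne_zero hk (hWn (s' hz)) i, h' z hz⟩⟩

theorem exists_tripleDefined (hα : StrictMono α) (hk : ∀ i, 0 < k i)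
    (i : Fin 2) {W : Set Phase} (hW : IsOpen W) (hne : W.Nonempty) (hWn : W ⊆ nonsingularSet α k) :
    ∃ W' ⊆ W, IsOpen W' ∧ W'.Nonempty ∧
      ∀ z ∈ W', TripleDefined (coeffs α k z) (divisorPoint α k z i) := by
  have hslit : W ⊆ slitPhaseSpace α := hWn.trans nonsingularSet_subset
  obtain ⟨W', s', o', n', h'⟩ := exists_isOpen_ne_zero
    (F := fun z => coeffs α k z 4 -
      (osculating (coeffs α k z) (divisorPoint α k z i)).b2 ^ 2) hW hne
    (fun z hz => by
      have ha := contDiffAt_coeffs (α := α) (k := k) (ne_of_mem_slitPhaseSpace (hslit hz))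
      exact (ha 4).sub ((contDiffAt_osculatingCoeff ha (contDiffAt_divisorPoint α k z i)
        (snd_divisorPoint_ne_zero hk (hWn hz) i)).pow 2))
    (fun z hz hd => by
      have hz' := hslit hz
      have hz0 := ne_of_mem_slitPhaseSpace hz'
      have hy := snd_divisorPoint_ne_zero hk (hWn hz) i
      have hP := (moves_divisorPoint (α := α) hk hz0 i i)
      rw [if_pos rfl] at hP
      obtain ⟨A, B, hA, hI⟩ := osculates_osculating (onCurve_divisorPoint (α := α) (k := k) hz0 i) hy
      have h4 : coeffs α k z 4 ≠ 0 := by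
        have := (ham_neg hk hz').ne
        simpa [coeffs] using this
      rw [← hA]
      exact Osculates.leading_ne_zero (A := A) (B := B)
        (hasDerivAt_flowField_coeffs (α := α) hk hz0 i)
        (by simpa using isNotSquare_coeffs hα hk (hWn hz)) (by simpa using h4) hP
        (by simpa using hy) (by simpa using hI) one_ne_zero (hd _))
  exact ⟨W', s', o', n', fun z hz => ⟨snd_divisorPoint_ne_zero hk (hWn (s' hz)) i, h' z hz⟩⟩

/-- Along `Xᵢ` the speeds are `m` and `1`. As `m ≥ 2`, we have `m² ≠ 1`, which separates the
abscissas, and `m + 1 ≠ 0`, which keeps the sum finite. -/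
theorem exists_addDefined_divisorPoint (hα : StrictMono α) (hk : ∀ i, 0 < k i)
    (hs : IsSqrtBranch α k s) (i : Fin 2) {m : ℕ} (hm : 2 ≤ m) {Q : Phase → ℂ × ℂ} {W : Set Phase}
    (hW : IsOpen W) (hne : W.Nonempty) (hWn : W ⊆ nonsingularSet α k)
    (hQ : ∀ z ∈ W, MovesAt α k i Q m z) :
    ∃ W' ⊆ W, IsOpen W' ∧ W'.Nonempty ∧
      ∀ z ∈ W', AddDefined (coeffs α k z) (s z) (Q z) (divisorPoint α k z i) := by
  have hP : ∀ z ∈ W, MovesAt α k i (fun w => divisorPoint α k w i) 1 z := fun z hz => by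
    simpa using movesAt_divisorPoint (α := α) hk
      (ne_of_mem_slitPhaseSpace (nonsingularSet_subset (hWn hz))) i i
  obtain ⟨W', s', o', n', h'⟩ := exists_isOpen_ne_zero
    (F := fun z => (Q z).1 - (divisorPoint α k z i).1) hW hne
    (fun z hz => (hQ z hz).smooth.fst.sub (hP z hz).smooth.fst) (fun z hz hd => by
      have hmul : Moves (fun t => coeffs α k (z + t • flowField α k i z))
        (fun t => Q (z + t • flowField α k i z)) (m * 1) := by simpa using (hQ z hz).moves
      have hm1 : (m : ℂ) ^ 2 ≠ 1 := by
        have : m ^ 2 ≠ 1 := by nlinarith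
        exact_mod_cast this
      have := (hP z hz).moves.fst_ne hmul one_ne_zero hm1
        (by simpa using snd_divisorPoint_ne_zero hk (hWn hz) i) (hd _)
      exact sub_ne_zero.2 (by simpa using this))
  obtain ⟨W₂, s₂, o₂, n₂, h₂⟩ := exists_chord_finite hα hk hs (i := i) (P := Q)
    (Q := fun w => divisorPoint α k w i) (μ₁ := m) (μ₂ := 1) (by exact_mod_cast m.succ_ne_zero)
    o' n' (s'.trans hWn) (fun z hz => hQ z (s' hz)) (fun z hz => hP z (s' hz))
    (fun z hz => sub_ne_zero.1 (h' z hz))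
  exact ⟨W₂, s₂.trans s', o₂, n₂, h₂⟩

theorem exists_mulDefined (rule : TriplingRule) (hα : StrictMono α) (hk : ∀ i, 0 < k i)
    (hs : IsSqrtBranch α k s) (i : Fin 2) {W : Set Phase} (hW : IsOpen W) (hne : W.Nonempty)
    (hWn : W ⊆ nonsingularSet α k) : ∀ m : ℕ, 0 < m →
    ∃ W' ⊆ W, IsOpen W' ∧ W'.Nonempty ∧
      ∀ z ∈ W', MulDefined rule (coeffs α k z) (s z) (divisorPoint α k z i) m
  | 0, h => absurd h (lt_irrefl 0)
  | 1, _ => ⟨W, subset_rfl, hW, hne, fun _ _ => trivial⟩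
  | 2, _ => exists_doubleDefined hα hk hs i hW hne hWn
  | 3, _ => by
    cases rule with
    | iterated =>
      obtain ⟨W₁, s₁, o₁, n₁, h₁⟩ := exists_doubleDefined hα hk hs i hW hne hWn
      obtain ⟨W₂, s₂, o₂, n₂, h₂⟩ := exists_addDefined_divisorPoint hα hk hs i le_rfl o₁ n₁
        (s₁.trans hWn) (Q := fun z => doublePoint (coeffs α k z) (s z) (divisorPoint α k z i))
        fun z hz => by
          simpa [mulPoint] using movesAt_mulPoint (rule := .iterated) (m := 2) hk hs
            (nonsingularSet_subset (hWn (s₁ hz))) i i (h₁ z hz)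
      exact ⟨W₂, s₂.trans s₁, o₂, n₂, fun z hz => ⟨h₁ z (s₂ hz), h₂ z hz⟩⟩
    | closed => exact exists_tripleDefined hα hk i hW hne hWn
  | m + 4, _ => by
    obtain ⟨W₁, s₁, o₁, n₁, h₁⟩ := exists_mulDefined rule hα hk hs i hW hne hWn (m + 3) (by omega)
    obtain ⟨W₂, s₂, o₂, n₂, h₂⟩ := exists_addDefined_divisorPoint (m := m + 3) hα hk hs i (by omega)
      o₁ n₁ (s₁.trans hWn)
      (Q := fun z => mulPoint rule (coeffs α k z) (s z) (divisorPoint α k z i) (m + 3))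
      fun z hz => by
        simpa using movesAt_mulPoint hk hs (nonsingularSet_subset (hWn (s₁ hz))) i i (h₁ z hz)
    exact ⟨W₂, s₂.trans s₁, o₂, n₂, fun z hz => ⟨h₁ z (s₂ hz), h₂ z hz⟩⟩

theorem exists_snd_ne_zero (hα : StrictMono α) (hk : ∀ i, 0 < k i)
    {i : Fin 2} {P : Phase → ℂ × ℂ} {μ : ℂ} (hμ : μ ≠ 0) {W : Set Phase}
    (hW : IsOpen W) (hne : W.Nonempty) (hWn : W ⊆ nonsingularSet α k)
    (hP : ∀ z ∈ W, MovesAt α k i P μ z) :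
    ∃ W' ⊆ W, IsOpen W' ∧ W'.Nonempty ∧ ∀ z ∈ W', (P z).2 ≠ 0 :=
  exists_isOpen_ne_zero (F := fun z => (P z).2) hW hne (fun z hz => (hP z hz).smooth.snd)
    fun z hz hd => by
      simpa using (hP z hz).moves.snd_ne_zero
        (by simpa using isSeparable_coeffs hα hk (hWn hz)) hμ (hd _)

theorem exists_regular (rule : TriplingRule) (hα : StrictMono α) (hk : ∀ i, 0 < k i)
    (hs : IsSqrtBranch α k s) {W : Set Phase} (hW : IsOpen W) (hne : W.Nonempty)
    (hWs : W ⊆ phaseSpace α) :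
    ∃ W' ⊆ W, IsOpen W' ∧ W'.Nonempty ∧ W' ⊆ nonsingularSet α k ∧
      W' ⊆ regularSet rule α k s := by
  obtain ⟨W₁, s₁, o₁, n₁, h₁⟩ := exists_nonsingular hk hW hne hWs
  obtain ⟨W₂, s₂, o₂, n₂, h₂⟩ := exists_mulDefined rule hα hk hs 0 o₁ n₁ h₁ (k 0) (hk 0)
  obtain ⟨W₃, s₃, o₃, n₃, h₃⟩ := exists_mulDefined rule hα hk hs 1 o₂ n₂ (s₂.trans h₁) (k 1) (hk 1)
  have hsub : W₃ ⊆ nonsingularSet α k := s₃.trans (s₂.trans h₁)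
  have hslit : W₃ ⊆ slitPhaseSpace α := hsub.trans nonsingularSet_subset
  have hm0 : ∀ z ∈ W₃, MovesAt α k 0 (fun w => multiple rule α k s w 0) (k 0) z := fun z hz => by
    simpa using movesAt_multiple hk hs (hslit hz) 0 0 (h₂ z (s₃ hz))
  have hm1 : ∀ z ∈ W₃, MovesAt α k 0 (fun w => multiple rule α k s w 1) 0 z := fun z hz => by
    simpa using movesAt_multiple hk hs (hslit hz) 0 1 (h₃ z hz)
  have hk0 : (k 0 : ℂ) ≠ 0 := by exact_mod_cast (hk 0).ne'
  obtain ⟨W₄, s₄, o₄, n₄, h₄⟩ := exists_snd_ne_zero hα hk hk0 o₃ n₃ hsub hm0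
  obtain ⟨W₅, s₅, o₅, n₅, h₅⟩ := exists_isOpen_ne_zero
    (F := fun z => (multiple rule α k s z 0).1 - (multiple rule α k s z 1).1) o₄ n₄
    (fun z hz => (hm0 z (s₄ hz)).smooth.fst.sub (hm1 z (s₄ hz)).smooth.fst) fun z hz hd => by
      -- Along `X₀` the second point rests, while the abscissa of the first has velocity `k₀ y`,
      -- which is nonzero after the previous shrinking.
      have e := ((hm0 z (s₄ hz)).moves.fst.sub (hm1 z (s₄ hz)).moves.fst).unique (hd _)
      have h0 := h₄ z hz
      simp [hk0, h0] at e
  refine ⟨W₅, s₅.trans (s₄.trans (s₃.trans (s₂.trans s₁))), o₅, n₅, s₅.trans (s₄.trans hsub),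
    fun z hz => ⟨hslit (s₄ (s₅ hz)), fun i => ?_, sub_ne_zero.1 (h₅ z hz)⟩⟩
  fin_cases i
  · exact h₂ z (s₃ (s₄ (s₅ hz)))
  · exact h₃ z (s₄ (s₅ hz))

/-! ### The regular set -/

theorem contDiffAt_multiple (hk : ∀ i, 0 < k i) (hs : IsSqrtBranch α k s)
    (hz : z ∈ regularSet rule α k s) (i : Fin 2) :
    ContDiffAt ℝ ∞ (fun w => multiple rule α k s w i) z :=
  (movesAt_multiple hk hs hz.1 0 i (hz.2.1 i)).smooth

theorem isOpen_regularSet (hk : ∀ i, 0 < k i) (hs : IsSqrtBranch α k s) :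
    IsOpen (regularSet rule α k s) := by
  refine isOpen_iff_mem_nhds.2 fun z hz => ?_
  have hm : ∀ i, ∀ᶠ w in nhds z,
      MulDefined rule (coeffs α k w) (s w) (divisorPoint α k w i) (k i) := fun i =>
    (contDiffAt_mulPoint rule (contDiffAt_coeffs (ne_of_mem_slitPhaseSpace hz.1))
      (hs.contDiffAt hk hz.1) (contDiffAt_divisorPoint α k z i) (k i) (hz.2.1 i)).2
  filter_upwards [(isOpen_slitPhaseSpace α).mem_nhds hz.1, Filter.eventually_all.2 hm,
    eventually_ne_zero ((contDiffAt_multiple hk hs hz 0).fst.sub (contDiffAt_multiple hk hs hz 1).fst)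
      (sub_ne_zero.2 hz.2.2)] with w h1 h2 h3
  exact ⟨h1, h2, sub_ne_zero.1 h3⟩

theorem phaseSpace_subset_closure_regularSet (rule : TriplingRule) (hα : StrictMono α)
    (hk : ∀ i, 0 < k i) (hs : IsSqrtBranch α k s) :
    phaseSpace α ⊆ closure (regularSet rule α k s) := fun z hz => by
  refine mem_closure_iff.2 fun O hO hzO => ?_
  obtain ⟨W, h1, -, ⟨w, hw⟩, -, h2⟩ := exists_regular rule hα hk hs
    (hO.inter (isOpen_phaseSpace α)) ⟨z, hzO, hz⟩ Set.inter_subset_right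
  exact ⟨w, (h1 hw).1, h2 hw⟩

/-! ### Euler's integral -/

theorem contDiffAt_eulerIntegral (hk : ∀ i, 0 < k i) (hs : IsSqrtBranch α k s)
    (hz : z ∈ regularSet rule α k s) : ContDiffAt ℝ ∞ (eulerIntegral rule α k s) z :=
  contDiffAt_eulerC (contDiffAt_coeffs (ne_of_mem_slitPhaseSpace hz.1))
    (contDiffAt_multiple hk hs hz 0) (contDiffAt_multiple hk hs hz 1) hz.2.2

theorem exists_intersects_multiple (hk : ∀ i, 0 < k i) (hs : IsSqrtBranch α k s)
    (hz : z ∈ regularSet rule α k s) :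
    ∃ A B, A = coeffs α k z 3 -
        2 * (chord (s z) (multiple rule α k s z 0) (multiple rule α k s z 1)).b1 *
        (chord (s z) (multiple rule α k s z 0) (multiple rule α k s z 1)).b2 ∧
      Intersects (coeffs α k z) (chord (s z) (multiple rule α k s z 0) (multiple rule α k s z 1)) A B
        (multiple rule α k s z 0).1 (multiple rule α k s z 1).1 := by
  have hO : ∀ i, OnCurve (coeffs α k z) (multiple rule α k s z i) := fun i => by
    simpa using (movesAt_multiple hk hs hz.1 0 i (hz.2.1 i)).moves.on
  exact intersects_chord (hs.sq_eq_coeffs hz.1) (hO 0) (hO 1) hz.2.2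

theorem fderiv_eulerIntegral_flowField (hk : ∀ i, 0 < k i) (hs : IsSqrtBranch α k s)
    (hz : z ∈ regularSet rule α k s) {A B : ℂ}
    (hI : Intersects (coeffs α k z) (chord (s z) (multiple rule α k s z 0)
      (multiple rule α k s z 1)) A B
        (multiple rule α k s z 0).1 (multiple rule α k s z 1).1) (i : Fin 2) :
    fderiv ℝ (eulerIntegral rule α k s) z (flowField α k i z) =
      k i * (B * ((chord (s z) (multiple rule α k s z 0) (multiple rule α k s z 1)).b1 +
          s z * ((multiple rule α k s z 0).1 + (multiple rule α k s z 1).1)) +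
        A * (s z * (multiple rule α k s z 0).1 * (multiple rule α k s z 1).1 -
          (chord (s z) (multiple rule α k s z 0) (multiple rule α k s z 1)).b0)) := by
  have d := hasDerivAt_line ((contDiffAt_eulerIntegral hk hs hz).differentiableAt (by simp))
    (flowField α k i z)
  have d' := hasDerivAt_eulerC (A := A) (B := B)
    (hasDerivAt_flowField_coeffs hk (ne_of_mem_slitPhaseSpace hz.1) i)
    (hs.hasDerivAt_flowField hk hz.1 i) (movesAt_multiple hk hs hz.1 i 0 (hz.2.1 0)).moves
    (movesAt_multiple hk hs hz.1 i 1 (hz.2.1 1)).moves (by simpa using hz.2.2) (by simpa using hI)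
  rw [d.unique d']
  simp only [zero_smul, add_zero]
  congr 1
  -- Only `[kᵢ]Pᵢ` moves along `Xᵢ`, so the sum of the two speeds is `kᵢ`.
  fin_cases i <;> simp

theorem poissonBracket_eulerIntegral (hk : ∀ i, 0 < k i) (hs : IsSqrtBranch α k s)
    (hz : z ∈ regularSet rule α k s) :
    poissonBracket (fun w => (ham α k w : ℂ)) (eulerIntegral rule α k s) z = 0 := by
  obtain ⟨A, B, -, hI⟩ := exists_intersects_multiple hk hs hz
  have h0 : (k 0 : ℂ) ≠ 0 := by exact_mod_cast (hk 0).ne'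
  have h1 : (k 1 : ℂ) ≠ 0 := by exact_mod_cast (hk 1).ne'
  rw [poissonBracket_ham hk (ne_of_mem_slitPhaseSpace hz.1), fderiv_eulerIntegral_flowField hk hs hz hI,
    fderiv_eulerIntegral_flowField hk hs hz hI, mul_div_cancel_left₀ _ h0,
    mul_div_cancel_left₀ _ h1, sub_self, mul_zero]

theorem fderiv_ham_flowField (hk : ∀ i, 0 < k i) (h : z.1 0 ≠ z.1 1) (i : Fin 2) :
    fderiv ℝ (fun w => (ham α k w : ℂ)) z (flowField α k i z) = 0 :=
  (hasDerivAt_line ((contDiffAt_ofReal (contDiffAt_ham h)).differentiableAt (by simp)) _).unique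
    (by simpa using (hasDerivAt_flowField_ham hk h i).ofReal_comp)

theorem fderiv_I₂_flowField (hk : ∀ i, 0 < k i) (h : z.1 0 ≠ z.1 1) (i : Fin 2) :
    fderiv ℝ (fun w => (I₂ α k w : ℂ)) z (flowField α k i z) = 0 :=
  (hasDerivAt_line ((contDiffAt_ofReal (contDiffAt_I₂ h)).differentiableAt (by simp)) _).unique
    (by simpa using (hasDerivAt_flowField_I₂ hk h i).ofReal_comp)

theorem poissonBracket_I₂ (hk : ∀ i, 0 < k i) (h : z.1 0 ≠ z.1 1) :
    poissonBracket (fun w => (ham α k w : ℂ)) (fun w => (I₂ α k w : ℂ)) z = 0 := by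
  rw [poissonBracket_ham hk h, fderiv_I₂_flowField hk h, fderiv_I₂_flowField hk h]
  simp

/-! ### Functional independence -/

/-- Were `X₀ C` zero on `W`, the relation `L(x₃) = 0` would hold on an open subset and could be
differentiated along `X₀`. This contradicts `y₃ ≠ 0`, which can be arranged on an open set because
the sum moves with speed `k₀ ≠ 0`. -/
theorem exists_fderiv_eulerIntegral_ne_zero (hα : StrictMono α) (hk : ∀ i, 0 < k i)
    (hs : IsSqrtBranch α k s) {W : Set Phase} (hW : IsOpen W) (hne : W.Nonempty)
    (hWn : W ⊆ nonsingularSet α k) (hWr : W ⊆ regularSet rule α k s) :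
    ∃ z ∈ W, fderiv ℝ (eulerIntegral rule α k s) z (flowField α k 0 z) ≠ 0 := by
  by_contra! hzero
  have hk0 : (k 0 : ℂ) ≠ 0 := by exact_mod_cast (hk 0).ne'
  have hm0 : ∀ z ∈ W, MovesAt α k 0 (fun w => multiple rule α k s w 0) (k 0) z := fun z hz => by
    simpa using movesAt_multiple hk hs (hWr hz).1 0 0 ((hWr hz).2.1 0)
  have hm1 : ∀ z ∈ W, MovesAt α k 0 (fun w => multiple rule α k s w 1) 0 z := fun z hz => by
    simpa using movesAt_multiple hk hs (hWr hz).1 0 1 ((hWr hz).2.1 1)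
  obtain ⟨W₁, s₁, o₁, n₁, h₁⟩ := exists_chord_finite hα hk hs (μ₁ := k 0) (μ₂ := 0) (by simpa using hk0)
    hW hne hWn hm0 hm1 fun z hz => (hWr hz).2.2
  have hT : ∀ z ∈ W₁, MovesAt α k 0 (fun w => addPoint (coeffs α k w) (s w)
      (multiple rule α k s w 0) (multiple rule α k s w 1)) (k 0) z := fun z hz => by
    simpa using (hm0 z (s₁ hz)).addPoint hk hs (hWr (s₁ hz)).1 (hm1 z (s₁ hz)) (h₁ z hz)
  obtain ⟨W₂, s₂, o₂, n₂, h₂⟩ := exists_snd_ne_zero hα hk hk0 o₁ n₁ (s₁.trans hWn) hT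
  have hL : ∀ z ∈ W₂, (addPoint (coeffs α k z) (s z)
      (multiple rule α k s z 0) (multiple rule α k s z 1)).2 + s z * ((addPoint (coeffs α k z) (s z)
      (multiple rule α k s z 0) (multiple rule α k s z 1)).1 - (multiple rule α k s z 0).1) *
      ((addPoint (coeffs α k z) (s z) (multiple rule α k s z 0) (multiple rule α k s z 1)).1 -
        (multiple rule α k s z 1).1) = 0 := fun z hz => by
    have hzr := hWr (s₁ (s₂ hz))
    obtain ⟨A, B, hA, hI⟩ := exists_intersects_multiple hk hs hzr
    have hA0 : A ≠ 0 := by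
      rw [hA, ← neg_sub]
      exact neg_ne_zero.2 (h₁ z (s₂ hz)).2
    have h := hzero z (s₁ (s₂ hz))
    rw [fderiv_eulerIntegral_flowField hk hs hzr hI] at h
    exact stationary_of_sum_eq hI hA0 ((mul_eq_zero.1 h).resolve_left hk0)
  obtain ⟨z, hz⟩ := n₂
  have hzr := hWr (s₁ (s₂ hz))
  have hd := (hasDerivAt_const (0 : ℝ) (0 : ℂ)).congr_of_eventuallyEq
    ((eventually_line_mem o₂ hz (flowField α k 0 z)).mono fun t ht => hL _ ht)
  refine h₂ z hz ?_
  simpa using moving_sum_snd_eq_zero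
    (hasDerivAt_flowField_coeffs hk (ne_of_mem_slitPhaseSpace hzr.1) 0)
    (hs.hasDerivAt_flowField hk hzr.1 0) (by simpa using hs.sq_eq_coeffs hzr.1)
    (by simpa using isNotSquare_coeffs hα hk (hWn (s₁ (s₂ hz))))
    (hm0 z (s₁ (s₂ hz))).moves (hm1 z (s₁ (s₂ hz))).moves hk0 (by simpa using h₁ z (s₂ hz))
    (by simpa using hL z hz) hd

/-- Evaluation on `X₀` isolates `dC`. The two momentum directions then give `g₀ = u₂ g₁` and `g₀ =
u₁ g₁`, since a change of `pⱼ` alters only the partial energy `Eⱼ`. -/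
theorem linearIndependent_fderiv (hk : ∀ i, 0 < k i) (hz : z ∈ nonsingularSet α k) {C : Phase → ℂ}
    (hC : fderiv ℝ C z (flowField α k 0 z) ≠ 0) :
    LinearIndependent ℂ (fun i => fderiv ℝ ((![fun z => (ham α k z : ℂ),
      fun z => (I₂ α k z : ℂ), C] : Fin 3 → Phase → ℂ) i) z) := by
  have hne := ne_of_mem_phaseSpace hz.1
  rw [Fintype.linearIndependent_iff]
  intro g hg
  simp only [Fin.sum_univ_three, Matrix.cons_val] at hg
  have hv : ∀ v, g 0 * fderiv ℝ (fun z => (ham α k z : ℂ)) z v +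
      g 1 * fderiv ℝ (fun z => (I₂ α k z : ℂ)) z v + g 2 * fderiv ℝ C z v = 0 := fun v => by
    simpa using DFunLike.congr_fun hg v
  have hg2 : g 2 = 0 := by
    have := hv (flowField α k 0 z)
    rw [fderiv_ham_flowField hk hne, fderiv_I₂_flowField hk hne] at this
    simpa [hC] using this
  have hkc : ∀ i, (k i : ℂ) ≠ 0 := fun i => by exact_mod_cast (hk i).ne'
  have hphi : ∀ i, (phi α (z.1 i) : ℂ) ≠ 0 := fun i => by exact_mod_cast phi_ne_zero hz.1 i
  have hp : ∀ i, (z.2 i : ℂ) ≠ 0 := fun i => by exact_mod_cast hz.2.1 i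
  have hu : (z.1 0 : ℂ) - z.1 1 ≠ 0 := by exact_mod_cast sub_ne_zero.2 hne
  have e0 : g 0 = z.1 1 * g 1 := by
    have := hv (0, Pi.single 0 1)
    rw [fderiv_ham hne, fderiv_I₂ hne, hg2] at this
    simp [partialEnergy'] at this
    have h0 := hkc 0
    have h1 := hphi 0
    have h2 := hp 0
    field_simp at this
    linear_combination (mul_eq_zero.1 (this.trans (mul_zero _))).resolve_left (by simp [h1, h2])
  have e1 : g 0 = z.1 0 * g 1 := by
    have := hv (0, Pi.single 1 1)
    rw [fderiv_ham hne, fderiv_I₂ hne, hg2] at this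
    simp [partialEnergy'] at this
    have h0 := hkc 1
    have h1 := hphi 1
    have h2 := hp 1
    field_simp at this
    linear_combination -(mul_eq_zero.1 (this.trans (mul_zero _))).resolve_left (by simp [h1, h2])
  have hg1 : g 1 = 0 := by
    have : ((z.1 0 : ℂ) - z.1 1) * g 1 = 0 := by linear_combination e0 - e1
    exact (mul_eq_zero.1 this).resolve_left hu
  intro i
  fin_cases i
  · simpa [hg1] using e0
  · exact hg1
  · exact hg2

theorem functionallyIndependentOn_regularSet (rule : TriplingRule) (hα : StrictMono α)
    (hk : ∀ i, 0 < k i) (hs : IsSqrtBranch α k s) :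
    FunctionallyIndependentOn ![fun z => (ham α k z : ℂ), fun z => (I₂ α k z : ℂ),
      eulerIntegral rule α k s] (regularSet rule α k s) := fun z hz => by
  refine mem_closure_iff.2 fun O hO hzO => ?_
  obtain ⟨W, h1, h2, h3, h4, h5⟩ := exists_regular rule hα hk hs
    (hO.inter (isOpen_regularSet (rule := rule) hk hs)) ⟨z, hzO, hz⟩ fun w hw => hw.2.1.1
  obtain ⟨w, hw, hw'⟩ := exists_fderiv_eulerIntegral_ne_zero hα hk hs h2 h3 h4 h5
  exact ⟨w, (h1 hw).1, (h1 hw).2, linearIndependent_fderiv hk (h4 hw) hw'⟩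

end Regular

section Elliptic

variable {α : Fin 3 → ℝ} {ε : Fin 3 → ℝ} {u : Fin 2 → ℝ}

/-! ### Elliptic coordinates -/

/-- The squares of the coordinates of the point with elliptic coordinates `u`. -/
noncomputable def ellipticSquares (α : Fin 3 → ℝ) (u : Fin 2 → ℝ) : Fin 3 → ℝ :=
  ![(α 0 - u 0) * (α 0 - u 1) / ((α 0 - α 1) * (α 0 - α 2)),
    (α 1 - u 0) * (α 1 - u 1) / ((α 1 - α 0) * (α 1 - α 2)),
    (α 2 - u 0) * (α 2 - u 1) / ((α 2 - α 0) * (α 2 - α 1))]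

/-- The point of the octant with signs `ε` that has elliptic coordinates `u`. -/
noncomputable def ellipticPoint (α ε : Fin 3 → ℝ) (u : Fin 2 → ℝ) : EuclideanSpace ℝ (Fin 3) :=
  WithLp.toLp 2 fun i => ε i * Real.sqrt (ellipticSquares α u i)

theorem ellipticSquares_pos (hu : u ∈ ellipticDomain α) (i : Fin 3) :
    0 < ellipticSquares α u i := by
  obtain ⟨h0, h1, h2, h3⟩ := hu
  fin_cases i
  · exact div_pos (mul_pos_of_neg_of_neg (by linarith) (by linarith))
      (mul_pos_of_neg_of_neg (by linarith) (by linarith))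
  · exact div_pos_of_neg_of_neg (mul_neg_of_pos_of_neg (by linarith) (by linarith))
      (mul_neg_of_pos_of_neg (by linarith) (by linarith))
  · exact div_pos (mul_pos (by linarith) (by linarith)) (mul_pos (by linarith) (by linarith))

theorem ellipticPoint_sq (hε : ∀ i, ε i = 1 ∨ ε i = -1) (hu : u ∈ ellipticDomain α) (i : Fin 3) :
    ellipticPoint α ε u i ^ 2 = ellipticSquares α u i := by
  have h1 : ε i ^ 2 = 1 := by rcases hε i with h | h <;> rw [h] <;> norm_num
  simp [ellipticPoint, mul_pow, h1, Real.sq_sqrt (ellipticSquares_pos hu i).le]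

theorem sum_ellipticSquares_div (hα : StrictMono α) (u : Fin 2 → ℝ) {z : ℝ}
    (hz : ∀ i, z ≠ α i) :
    ∑ i, ellipticSquares α u i / (z - α i) = (z - u 0) * (z - u 1) / phi α z := by
  have h01 := sub_ne_zero.2 (hα.injective.ne (show (0 : Fin 3) ≠ 1 by decide))
  have h02 := sub_ne_zero.2 (hα.injective.ne (show (0 : Fin 3) ≠ 2 by decide))
  have h12 := sub_ne_zero.2 (hα.injective.ne (show (1 : Fin 3) ≠ 2 by decide))
  have h10 := sub_ne_zero.2 (hα.injective.ne (show (1 : Fin 3) ≠ 0 by decide))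
  have h20 := sub_ne_zero.2 (hα.injective.ne (show (2 : Fin 3) ≠ 0 by decide))
  have h21 := sub_ne_zero.2 (hα.injective.ne (show (2 : Fin 3) ≠ 1 by decide))
  have z0 := sub_ne_zero.2 (hz 0)
  have z1 := sub_ne_zero.2 (hz 1)
  have z2 := sub_ne_zero.2 (hz 2)
  have e1 : α 1 - α 0 = -(α 0 - α 1) := by ring
  have e2 : α 2 - α 0 = -(α 0 - α 2) := by ring
  have e3 : α 2 - α 1 = -(α 1 - α 2) := by ring
  simp only [Fin.sum_univ_three, ellipticSquares, Matrix.cons_val, phi, e1, e2, e3]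
  field_simp
  ring

theorem sum_ellipticSquares (hα : StrictMono α) (u : Fin 2 → ℝ) :
    ∑ i, ellipticSquares α u i = 1 := by
  have h01 := sub_ne_zero.2 (hα.injective.ne (show (0 : Fin 3) ≠ 1 by decide))
  have h02 := sub_ne_zero.2 (hα.injective.ne (show (0 : Fin 3) ≠ 2 by decide))
  have h12 := sub_ne_zero.2 (hα.injective.ne (show (1 : Fin 3) ≠ 2 by decide))
  have e1 : α 1 - α 0 = -(α 0 - α 1) := by ring
  have e2 : α 2 - α 0 = -(α 0 - α 2) := by ring
  have e3 : α 2 - α 1 = -(α 1 - α 2) := by ring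
  simp only [Fin.sum_univ_three, ellipticSquares, Matrix.cons_val, e1, e2, e3]
  field_simp
  ring

theorem contDiffAt_ellipticPoint (ε : Fin 3 → ℝ) (hu : u ∈ ellipticDomain α) :
    ContDiffAt ℝ ∞ (ellipticPoint α ε) u := by
  refine contDiffAt_euclidean.2 fun i => ?_
  refine contDiffAt_const.mul (ContDiffAt.sqrt ?_ (ellipticSquares_pos hu i).ne')
  fin_cases i <;> simp [ellipticSquares] <;> fun_prop

theorem mapsTo_ellipticPoint (hα : StrictMono α) (hε : ∀ i, ε i = 1 ∨ ε i = -1) :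
    Set.MapsTo (ellipticPoint α ε) (ellipticDomain α) (sphereOctant ε) := by
  refine fun u hu => ⟨?_, fun i => ?_⟩
  · rw [mem_sphere_zero_iff_norm, EuclideanSpace.norm_eq]
    simp only [Real.norm_eq_abs, sq_abs, ellipticPoint_sq hε hu, sum_ellipticSquares hα,
      Real.sqrt_one]
  · have h1 : ε i * ε i = 1 := by rcases hε i with h | h <;> rw [h] <;> norm_num
    simp only [ellipticPoint]
    rw [← mul_assoc, h1, one_mul]
    exact Real.sqrt_pos.2 (ellipticSquares_pos hu i)

/-- The squares of its coordinates determine the elliptic coordinates of a point. -/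
theorem ellipticSquares_injOn (hα : StrictMono α) :
    Set.InjOn (ellipticSquares α) (ellipticDomain α) := by
  intro u hu v hv h
  have h01 := sub_ne_zero.2 (hα.injective.ne (show (0 : Fin 3) ≠ 1 by decide))
  have h02 := sub_ne_zero.2 (hα.injective.ne (show (0 : Fin 3) ≠ 2 by decide))
  have h12 := sub_ne_zero.2 (hα.injective.ne (show (1 : Fin 3) ≠ 2 by decide))
  have h10 := sub_ne_zero.2 (hα.injective.ne (show (1 : Fin 3) ≠ 0 by decide))
  have e0 := congrFun h 0
  have e1 := congrFun h 1
  simp only [ellipticSquares, Matrix.cons_val] at e0 e1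
  rw [div_left_inj' (mul_ne_zero h01 h02)] at e0
  rw [div_left_inj' (mul_ne_zero h10 h12)] at e1
  have es : u 0 + u 1 = v 0 + v 1 := mul_left_cancel₀ h01 (by linear_combination e1 - e0)
  have ep : u 0 * u 1 = v 0 * v 1 := by linear_combination e0 + α 0 * es
  have e : (u 0 - v 0) * (u 0 - v 1) = 0 := by linear_combination u 0 * es - ep
  -- Sum and product fix the pair up to order; the interlacing with `α₂` rules out the swap.
  have hlt : u 0 < v 1 := hu.2.1.trans hv.2.2.1
  have f0 : u 0 = v 0 := sub_eq_zero.1 ((mul_eq_zero.1 e).resolve_right (sub_neg.2 hlt).ne)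
  have f1 : u 1 = v 1 := by linarith
  ext i
  fin_cases i
  · exact f0
  · exact f1

/-- The numerator `G` of `∑ wᵢ / (z - αᵢ)` is a quadratic, monic because `∑ wᵢ = 1`. Its signs at
the three `αᵢ` are `+, -, +`, so it has one root in each gap, and these roots are the coordinates.
-/
theorem ellipticSquares_surjOn (hα : StrictMono α) {w : Fin 3 → ℝ} (hw : ∀ i, 0 < w i)
    (hs : ∑ i, w i = 1) : ∃ u ∈ ellipticDomain α, ellipticSquares α u = w := by
  have h01 : α 0 < α 1 := hα (by decide)
  have h12 : α 1 < α 2 := hα (by decide)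
  rw [Fin.sum_univ_three] at hs
  set G : ℝ → ℝ := fun z => w 0 * ((z - α 1) * (z - α 2)) + w 1 * ((z - α 0) * (z - α 2)) +
    w 2 * ((z - α 0) * (z - α 1)) with hG
  have hc : Continuous G := by fun_prop
  have g0 : 0 < G (α 0) := by
    have : G (α 0) = w 0 * ((α 0 - α 1) * (α 0 - α 2)) := by simp [hG]
    rw [this]
    exact mul_pos (hw 0) (mul_pos_of_neg_of_neg (by linarith) (by linarith))
  have g1 : G (α 1) < 0 := by
    have : G (α 1) = w 1 * ((α 1 - α 0) * (α 1 - α 2)) := by simp [hG]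
    rw [this]
    exact mul_neg_of_pos_of_neg (hw 1) (mul_neg_of_pos_of_neg (by linarith) (by linarith))
  have g2 : 0 < G (α 2) := by
    have : G (α 2) = w 2 * ((α 2 - α 0) * (α 2 - α 1)) := by simp [hG]
    rw [this]
    exact mul_pos (hw 2) (mul_pos (by linarith) (by linarith))
  obtain ⟨x, ⟨hx0, hx1⟩, hx⟩ := intermediate_value_Ioo' h01.le hc.continuousOn ⟨g1, g0⟩
  obtain ⟨y, ⟨hy0, hy1⟩, hy⟩ := intermediate_value_Ioo h12.le hc.continuousOn ⟨g1, g2⟩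
  have hxy : x - y ≠ 0 := (sub_neg.2 (hx1.trans hy0)).ne
  have hw2 : w 2 = 1 - w 0 - w 1 := by linarith
  simp only [hG, hw2] at hx hy
  have es : x + y = w 0 * (α 1 + α 2) + w 1 * (α 0 + α 2) + (1 - w 0 - w 1) * (α 0 + α 1) :=
    mul_left_cancel₀ hxy (by linear_combination hx - hy)
  have ep : x * y = w 0 * (α 1 * α 2) + w 1 * (α 0 * α 2) + (1 - w 0 - w 1) * (α 0 * α 1) := by
    linear_combination x * es - hx
  refine ⟨![x, y], ⟨hx0, hx1, hy0, hy1⟩, ?_⟩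
  have n01 := sub_ne_zero.2 h01.ne
  have n10 := sub_ne_zero.2 h01.ne'
  have n12 := sub_ne_zero.2 h12.ne
  have n21 := sub_ne_zero.2 h12.ne'
  have n02 := sub_ne_zero.2 (h01.trans h12).ne
  have n20 := sub_ne_zero.2 (h01.trans h12).ne'
  ext i
  fin_cases i <;> simp [ellipticSquares, hw2]
  · rw [div_eq_iff (mul_ne_zero n01 n02)]
    linear_combination ep - α 0 * es
  · rw [div_eq_iff (mul_ne_zero n10 n12)]
    linear_combination ep - α 1 * es
  · rw [div_eq_iff (mul_ne_zero n20 n21)]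
    linear_combination ep - α 2 * es

theorem bijOn_ellipticPoint (hα : StrictMono α) (hε : ∀ i, ε i = 1 ∨ ε i = -1) :
    Set.BijOn (ellipticPoint α ε) (ellipticDomain α) (sphereOctant ε) := by
  refine ⟨mapsTo_ellipticPoint hα hε, fun u hu v hv h => ?_, fun q hq => ?_⟩
  · refine ellipticSquares_injOn hα hu hv (funext fun i => ?_)
    rw [← ellipticPoint_sq hε hu, ← ellipticPoint_sq hε hv, h]
  · have hq0 : ∀ i, q i ≠ 0 := fun i h => by
      have := hq.2 i
      rw [h, mul_zero] at this
      exact lt_irrefl _ this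
    have hs : ∑ i, q i ^ 2 = 1 := by
      have := mem_sphere_zero_iff_norm.1 hq.1
      rw [EuclideanSpace.norm_eq, Real.sqrt_eq_one] at this
      simpa using this
    obtain ⟨u, hu, hqu⟩ := ellipticSquares_surjOn hα (w := fun i => q i ^ 2)
      (fun i => by have := hq0 i; positivity) hs
    refine ⟨u, hu, ?_⟩
    ext i
    have := hq.2 i
    simp only [ellipticPoint, hqu, Real.sqrt_sq_eq_abs]
    rcases hε i with h | h <;> rw [h] at this ⊢
    · rw [abs_of_pos (by linarith), one_mul]
    · rw [abs_of_neg (by linarith)]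
      ring

/-- If the point is stationary, so are its squared coordinates, hence `(c - u₁)(c - u₂)` at `c = α₁,
α₂`. The derivative is affine in `c`, so it vanishes identically, and `u₁ ≠ u₂` gives `v = 0`. -/
theorem injective_fderiv_ellipticPoint (hα : StrictMono α) (hε : ∀ i, ε i = 1 ∨ ε i = -1)
    (hu : u ∈ ellipticDomain α) : Function.Injective (fderiv ℝ (ellipticPoint α ε) u) := by
  refine (injective_iff_map_eq_zero _).2 fun v hv => ?_
  have d := ((contDiffAt_ellipticPoint ε hu).differentiableAt (by simp)).hasFDerivAt.hasLineDerivAt v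
  rw [hv] at d
  have hline : ∀ j, HasDerivAt (fun t : ℝ => (u + t • v) j) (v j) 0 := fun j => by
    simpa using ((hasDerivAt_id (0 : ℝ)).mul_const (v j)).const_add (u j)
  have hmem : ∀ᶠ t : ℝ in nhds 0, u + t • v ∈ ellipticDomain α := by
    have : Continuous fun t : ℝ => u + t • v := by fun_prop
    exact this.continuousAt.eventually_mem ((isOpen_ellipticDomain α).mem_nhds (by simpa using hu))
  have hsq : ∀ i, HasDerivAt (fun t : ℝ => ellipticSquares α (u + t • v) i) 0 0 := fun i => by
    have di : HasDerivAt (fun t : ℝ => ellipticPoint α ε (u + t • v) i) 0 0 :=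
      (EuclideanSpace.proj (𝕜 := ℝ) i).hasFDerivAt.comp_hasDerivAt (0 : ℝ) d
    have di2 := di.pow 2
    rw [mul_zero] at di2
    refine di2.congr_of_eventuallyEq ?_
    filter_upwards [hmem] with t ht
    exact (ellipticPoint_sq hε ht i).symm
  have h01 := sub_ne_zero.2 (hα.injective.ne (show (0 : Fin 3) ≠ 1 by decide))
  have h02 := sub_ne_zero.2 (hα.injective.ne (show (0 : Fin 3) ≠ 2 by decide))
  have h12 := sub_ne_zero.2 (hα.injective.ne (show (1 : Fin 3) ≠ 2 by decide))
  have h10 := sub_ne_zero.2 (hα.injective.ne (show (1 : Fin 3) ≠ 0 by decide))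
  have e : ∀ c : ℝ, HasDerivAt (fun t : ℝ => (c - (u + t • v) 0) * (c - (u + t • v) 1))
      (-(v 0 * (c - u 1) + v 1 * (c - u 0))) 0 := fun c => by
    refine (((hline 0).const_sub c).mul ((hline 1).const_sub c)).congr_deriv ?_
    simp
    ring
  have e0 := (hsq 0).unique ((e (α 0)).div_const ((α 0 - α 1) * (α 0 - α 2)))
  have e1 := (hsq 1).unique ((e (α 1)).div_const ((α 1 - α 0) * (α 1 - α 2)))
  rw [eq_comm, div_eq_zero_iff, or_iff_left (mul_ne_zero h01 h02)] at e0
  rw [eq_comm, div_eq_zero_iff, or_iff_left (mul_ne_zero h10 h12)] at e1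
  have s1 : v 0 + v 1 = 0 := (mul_eq_zero.1 (show (α 0 - α 1) * (v 0 + v 1) = 0 by
    linear_combination e1 - e0)).resolve_left h01
  have hlt : u 0 - u 1 ≠ 0 := (sub_neg.2 (hu.2.1.trans hu.2.2.1)).ne
  have s2 : v 0 = 0 := (mul_eq_zero.1 (show (u 0 - u 1) * v 0 = 0 by
    linear_combination (u 0 - α 0) * s1 - e0)).resolve_left hlt
  ext i
  fin_cases i
  · exact s2
  · simpa [s2] using s1

theorem isEllipticParametrization_ellipticPoint (hα : StrictMono α)
    (hε : ∀ i, ε i = 1 ∨ ε i = -1) : IsEllipticParametrization α ε (ellipticPoint α ε) where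
  smooth u hu := (contDiffAt_ellipticPoint ε hu).contDiffWithinAt
  bijOn := bijOn_ellipticPoint hα hε
  elliptic u hu z hz := by
    simp only [ellipticPoint_sq hε hu]
    exact sum_ellipticSquares_div hα u hz
  immersion u hu := injective_fderiv_ellipticPoint hα hε hu

/-! ### The metric -/

theorem posDef_neg_metric {k : Fin 2 → ℕ} (hk : ∀ i, 0 < k i) (hu : u ∈ ellipticDomain α) :
    (-metric α k u).PosDef := by
  have hz : ((u, 0) : Phase) ∈ phaseSpace α := hu
  have h0 := phi_pos hz
  have h1 := phi_neg hz
  have hd : u 0 - u 1 < 0 := sub_neg.2 (hu.2.1.trans hu.2.2.1)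
  have k0 : (0 : ℝ) < k 0 := by exact_mod_cast hk 0
  have k1 : (0 : ℝ) < k 1 := by exact_mod_cast hk 1
  have e : -metric α k u = Matrix.diagonal ![-(phi α (u 0)) / (k 0 : ℝ) ^ 2 / (u 0 - u 1),
      phi α (u 1) / (k 1 : ℝ) ^ 2 / (u 0 - u 1)] := by
    ext i j
    fin_cases i <;> fin_cases j <;> simp [metric, phi] <;> ring
  rw [e, Matrix.posDef_diagonal_iff]
  intro i
  fin_cases i
  · exact div_pos_of_neg_of_neg (div_neg_of_neg_of_pos (neg_neg_of_pos h0) (by positivity)) hd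
  · exact div_pos_of_neg_of_neg (div_neg_of_neg_of_pos h1 (by positivity)) hd

end Elliptic

end EulerSphere

theorem proposition2 (α : Fin 3 → ℝ) (hα : StrictMono α) (k : Fin 2 → ℕ) (hk : ∀ i, 0 < k i) :
    -- elliptic coordinates parametrize every open octant of the sphere
    (∀ ε : Fin 3 → ℝ, (∀ i, ε i = 1 ∨ ε i = -1) →
      ∃ Φ, EulerSphere.IsEllipticParametrization α ε Φ) ∧
    -- the quadratic form `g` is definite
    (∀ u ∈ EulerSphere.ellipticDomain α, (-EulerSphere.metric α k u).PosDef) ∧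
    -- `H` itself is smooth, and `I₂` is a first integral
    ContDiffOn ℝ ∞ (fun z => (EulerSphere.ham α k z : ℂ)) (EulerSphere.phaseSpace α) ∧
    EulerSphere.IsFirstIntegralOn (fun z => (EulerSphere.ham α k z : ℂ))
      (fun z => (EulerSphere.I₂ α k z : ℂ)) (EulerSphere.phaseSpace α) ∧
    -- the square root `√a₄ = √H` has continuous branches
    (∃ s, EulerSphere.IsSqrtBranch α k s) ∧
    -- for every branch, `C_{k₁k₂}` is a first integral, independent of `H` and `I₂`
    ∀ (rule : EulerSphere.TriplingRule) (s : EulerSphere.Phase → ℂ),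
      EulerSphere.IsSqrtBranch α k s →
      IsOpen (EulerSphere.regularSet rule α k s) ∧
      EulerSphere.phaseSpace α ⊆ closure (EulerSphere.regularSet rule α k s) ∧
      EulerSphere.IsFirstIntegralOn (fun z => (EulerSphere.ham α k z : ℂ))
        (EulerSphere.eulerIntegral rule α k s) (EulerSphere.regularSet rule α k s) ∧
      EulerSphere.FunctionallyIndependentOn
        ![fun z => (EulerSphere.ham α k z : ℂ), fun z => (EulerSphere.I₂ α k z : ℂ),
          EulerSphere.eulerIntegral rule α k s]
        (EulerSphere.regularSet rule α k s) := by
  open EulerSphere in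
  exact ⟨fun ε hε => ⟨ellipticPoint α ε, isEllipticParametrization_ellipticPoint hα hε⟩,
    fun u hu => posDef_neg_metric hk hu,
    fun z hz => (contDiffAt_ofReal (contDiffAt_ham (ne_of_mem_phaseSpace hz))).contDiffWithinAt,
    ⟨fun z hz => (contDiffAt_ofReal (contDiffAt_I₂ (ne_of_mem_phaseSpace hz))).contDiffWithinAt,
      fun z hz => poissonBracket_I₂ hk (ne_of_mem_phaseSpace hz)⟩,
    exists_isSqrtBranch hk,
    fun rule s hs => ⟨isOpen_regularSet hk hs,
      phaseSpace_subset_closure_regularSet rule hα hk hs,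
      ⟨fun z hz => (contDiffAt_eulerIntegral hk hs hz).contDiffWithinAt,
        fun z hz => poissonBracket_eulerIntegral hk hs hz⟩,
      functionallyIndependentOn_regularSet rule hα hk hs⟩⟩
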